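/- Let $n\ge 0$, and on $\mathbb C^{2n}=\{(P,Q):P,Q\in\mathbb C^n\}$ let $\omega((P,Q),(P',Q'))=\sum_{j}(P_jQ_j'-P_j'Q_j)$ (complex bilinear), and let $*$ denote entrywise complex conjugation. Let $\mathcal L_k\subset\mathbb R^{2n}$ be a $k$-dimensional real subspace that is isotropic for $\omega$, let $\mathcal L_k^{\mathbb C}\subset\mathbb C^{2n}$ be its complexification, let $W^{\perp\omega}=\{Y:\omega(Y,X)=0\ \forall X\in W\}$, and let $\mu$ be a Haar (translation-invariant) measure on $\mathcal L_k$. For $Y=(P,Q)\in\mathbb C^{2n}$ put $\Omega(Y)=\sum_j\big(P_j\xi_j-Q_j\frac1i\frac{\partial}{\partial\xi_j}\big)$, acting on the Schwartz space $\mathcal S(\mathbb R^n)$; for real $X=(P,Q)$ one has $(e^{i\Omega(X)}\psi)(\xi)=e^{iP\cdot\xi-\frac i2P\cdot Q}\psi(\xi-Q)$. For $f,g\in\mathcal S(\mathbb R^n)$ put $$\langle f,g\rangle=\int_{\mathcal L_k}d\mu(X)\int_{\mathbb R^n}d\xi\,\overline{f(\xi)}\,(e^{i\Omega(X)}g)(\xi),\qquad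 \|f\|^2=\langle f,f\rangle .$$ The H-germ of $\psi\in\mathcal S(\mathbb R^n)$ is $\{Y\in(\mathcal L_k^{\mathbb C})^{\perp\omega}:\ \|\Omega(Y)\psi\|=0\}$. Let $\check r\subset\mathbb C^{2n}$ be a complex subspace of dimension $n$ such that 1. $\omega(Y_1,Y_2)=0$ for all $Y_1,Y_2\in\check r$; 2. every $Y\in\mathcal L_k^{\mathbb C}$ satisfies $Y\in\check r$ and $\omega(Y,Y^*)=0$; 3. $\frac1i\,\omega(Y,Y^*)>0$ for every $Y\in\check r\setminus\mathcal L_k^{\mathbb C}$. Then $$(\mathcal L_k^{\mathbb C})^{\perp\omega}=\check r+\check r^*,\qquad \check r\cap\check r^*=\mathcal L_k^{\mathbb C},$$ and there is a symmetric complex $n\times n$ matrix $A$ with positive definite imaginary part such that, for every constant $c\ne0$, the Gaussian function $\psi_A(\xi)=c\exp\big(\frac i2\sum_{j,l}\xi_jA_{jl}\xi_l\big)$ belongs to $\mathcal S(\mathbb R^n)$ and has H-germ $\check r(A)=\check r$. -/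

import Mathlib

open scoped SchwartzMap

noncomputable section

/-- Pairs `(P, Q)` of momenta and coordinates: `Phase n ℝ` is the phase space `ℝ²ⁿ`,
`Phase n ℂ` is its complexification. -/
abbrev Phase (n : ℕ) (𝕜 : Type) : Type := (Fin n → 𝕜) × (Fin n → 𝕜)

/-- The symplectic form `ω((P,Q),(P',Q')) = ∑ j, (P j * Q' j - P' j * Q j)`; over `ℂ` it is
complex bilinear. -/
def symplForm {n : ℕ} {𝕜 : Type} [CommRing 𝕜] (X X' : Phase n 𝕜) : 𝕜 :=
  ∑ j, (X.1 j * X'.2 j - X'.1 j * X.2 j)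

/-- The inclusion `ℝ²ⁿ → ℂ²ⁿ`. -/
def Phase.toComplex {n : ℕ} (X : Phase n ℝ) : Phase n ℂ :=
  (fun j => (X.1 j : ℂ), fun j => (X.2 j : ℂ))

/-- The complexification `L^ℂ ⊆ ℂ²ⁿ` of a real subspace `L ⊆ ℝ²ⁿ`. -/
def complexify {n : ℕ} (L : Submodule ℝ (Phase n ℝ)) : Submodule ℂ (Phase n ℂ) :=
  Submodule.span ℂ (Phase.toComplex '' (L : Set (Phase n ℝ)))

/-- The skew-orthogonal complement `W^{⊥ω}` of a complex subspace `W`. -/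
def skewOrth {n : ℕ} (W : Submodule ℂ (Phase n ℂ)) : Submodule ℂ (Phase n ℂ) where
  carrier := {Y | ∀ X ∈ W, symplForm Y X = 0}
  zero_mem' := by
    intro X _
    simp [symplForm]
  add_mem' := by
    intro Y Z hY hZ X hX
    have h : symplForm (Y + Z) X = symplForm Y X + symplForm Z X := by
      simp only [symplForm, ← Finset.sum_add_distrib]
      exact Finset.sum_congr rfl fun j _ => by simp; ring
    rw [h, hY X hX, hZ X hX, add_zero]
  smul_mem' := by
    intro c Y hY X hX
    have h : symplForm (c • Y) X = c * symplForm Y X := by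
      simp only [symplForm, Finset.mul_sum]
      exact Finset.sum_congr rfl fun j _ => by simp; ring
    rw [h, hY X hX, mul_zero]

/-- The complex conjugate `r^* = {Y^* | Y ∈ r}` of a complex subspace; conjugation `star` is
entrywise and involutive, so membership `Y ∈ r^*` is written `Y^* ∈ r`. -/
def conjSubspace {n : ℕ} (r : Submodule ℂ (Phase n ℂ)) : Submodule ℂ (Phase n ℂ) where
  carrier := {Y | star Y ∈ r}
  zero_mem' := by
    simp
  add_mem' := by
    intro Y Z hY hZ
    simpa using r.add_mem hY hZ
  smul_mem' := by
    intro c Y hY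
    simpa using r.smul_mem (star c) hY

/-- The operator `Ω(P,Q) = ∑ j, (P j * ξ j - Q j * (1/i) * ∂/∂ξ j)` applied to a wave function. -/
def OmegaOp {n : ℕ} (Y : Phase n ℂ) (ψ : (Fin n → ℝ) → ℂ) : (Fin n → ℝ) → ℂ := fun ξ =>
  ∑ j, (Y.1 j * (ξ j : ℂ) * ψ ξ
    - Y.2 j * ((1 / Complex.I) * fderiv ℝ ψ ξ (Pi.single j 1)))

/-- The Weyl operator `e^{iΩ(X)}` for real `X = (P,Q)`:
`(e^{iΩ(X)} ψ)(ξ) = e^{i P·ξ - (i/2) P·Q} ψ(ξ - Q)`. -/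
def weyl {n : ℕ} (X : Phase n ℝ) (ψ : (Fin n → ℝ) → ℂ) : (Fin n → ℝ) → ℂ := fun ξ =>
  Complex.exp (Complex.I * ((∑ j, X.1 j * ξ j - (1 / 2) * ∑ j, X.1 j * X.2 j : ℝ) : ℂ))
    * ψ (ξ - X.2)

/-- The inner product `⟨f, g⟩ = ∫_{L} dμ(X) (f, e^{iΩ(X)} g)`, where
`(f, g) = ∫ conj (f ξ) * g ξ dξ` is the inner product of `L²(ℝⁿ)`. -/
def constraintInner {n : ℕ} (L : Submodule ℝ (Phase n ℝ)) (μ : MeasureTheory.Measure L)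
    (f g : (Fin n → ℝ) → ℂ) : ℂ :=
  ∫ X : L, (∫ ξ : Fin n → ℝ, star (f ξ) * weyl (X : Phase n ℝ) g ξ) ∂μ

/-- The H-germ of a state `ψ`: the vectors `Y` skew-orthogonal to the constraint plane (those for
which `Ω(Y)` is an operator on equivalence classes of states) such that `Ω(Y) ψ` is a zero-norm
state. -/
def hGerm {n : ℕ} (L : Submodule ℝ (Phase n ℝ)) (μ : MeasureTheory.Measure L)
    (ψ : 𝓢(Fin n → ℝ, ℂ)) : Set (Phase n ℂ) :=
  {Y | Y ∈ skewOrth (complexify L) ∧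
    constraintInner L μ (OmegaOp Y ψ) (OmegaOp Y ψ) = 0}

/-- The Gaussian wave function `c * exp((i/2) ∑ j k, ξ j * A j k * ξ k)`. -/
def gaussian {n : ℕ} (A : Matrix (Fin n) (Fin n) ℂ) (c : ℂ) : (Fin n → ℝ) → ℂ := fun ξ =>
  c * Complex.exp ((Complex.I / 2) * ∑ j, ∑ k, (ξ j : ℂ) * A j k * (ξ k : ℂ))

end

/-! ### Gaussians on a finite-dimensional real space: Schwartz decay and integration by parts. -/

section GaussianIntegrals

open MeasureTheory

variable {V : Type*} [NormedAddCommGroup V] [NormedSpace ℝ V]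

/-! Write J(P,Q) = (-Q,P), X·Y for the bilinear dot product, and (Y,Z) = ω(Y,Z*)/i.

The subspace identities are linear algebra. On r ∩ r* isotropy gives ω(Y,Y*) = 0, so strict
positivity forces Y into L^ℂ. As r and r* are Lagrangian, r + r* has skew complement r ∩ r* = L^ℂ;
take complements once more.

Since (·,·) vanishes on L^ℂ, r need not be the graph P = AQ of a symmetric A with Im A > 0. Split r
= L^ℂ ⊕ N with N·L^ℂ = 0, and move only the null part, X ↦ X - iJX. The image of r is still
Lagrangian and now strictly positive, hence such a graph (`exists_matrix_of_nonneg_lagrangian`).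

Since Ω(P,Q)ψ_A = ((P - AQ)·ξ)ψ_A, the graph annihilates ψ_A. It contains N but no nonzero vector of
L, so Ω(X₀)ψ_A for X₀ in L^ℂ can become null only after integration over L. A general Y in r + r* is
X₀ + V + W* with V, W in N; modulo the graph it is d*, where d = (X₀* - iJX₀*)/2 + W. With b = (X -
iJX)/2, the integral over ξ is a constant times ((d,d) - (d,b)(b,d)) exp(-(b,b)/2)
(`integral_star_OmegaOp_mul_weyl`). Integrated over X in L, the X₀ terms cancel and a nonzero
multiple of (W,W) remains (`constraintInner_OmegaOp_gaussian`). It vanishes exactly when W lies in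
L^ℂ, that is, when Y lies in r. -/

theorem Complex.norm_iteratedFDeriv_real_exp (i : ℕ) (z : ℂ) :
    ‖iteratedFDeriv ℝ i Complex.exp z‖ = ‖Complex.exp z‖ := by
  have h := (Complex.contDiff_exp (𝕜 := ℂ) (n := i)).contDiffAt (x := z)
    |>.restrictScalars_iteratedFDeriv (𝕜 := ℝ)
  have h' : iteratedFDeriv ℝ i Complex.exp z
      = (iteratedFDeriv ℂ i Complex.exp z).restrictScalars ℝ := by
    simpa using h.symm
  rw [h', ContinuousMultilinearMap.norm_restrictScalars, norm_iteratedFDeriv_eq_norm_iteratedDeriv,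
    iteratedDeriv_eq_iterate, Complex.iter_deriv_exp]

/-- The exponential of a function of temperate growth whose real part tends to `-∞` at least
linearly is a Schwartz function. -/
theorem exists_schwartz_cexp {Φ : V → ℂ} (hΦ : Φ.HasTemperateGrowth) {C : ℝ}
    (hre : ∀ x, (Φ x).re ≤ C - ‖x‖) : ∃ g : 𝓢(V, ℂ), ∀ x, g x = Complex.exp (Φ x) := by
  have hsm : ContDiff ℝ ((⊤ : ℕ∞) : WithTop ℕ∞) fun x => Complex.exp (Φ x) :=
    Complex.contDiff_exp.comp hΦ.1
  refine ⟨⟨fun x => Complex.exp (Φ x), hsm, fun m i => ?_⟩, fun x => rfl⟩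
  obtain ⟨k, D, hD, hk⟩ := hΦ.norm_iteratedFDeriv_le_uniform i
  -- Faà di Bruno leaves a polynomial factor of degree m + ki, absorbed by N! exp(1 + ‖x‖) against
  -- exp(C - ‖x‖). Using 1 + D instead of D makes the base at least 1, so its first power is below
  -- its j-th.
  refine ⟨(i.factorial * (1 + D) ^ i) * (Real.exp (C + 1) * (m + k * i).factorial), fun x => ?_⟩
  have h1 : ‖iteratedFDeriv ℝ i (Complex.exp ∘ Φ) x‖
      ≤ i.factorial * Real.exp (C - ‖x‖) * ((1 + D) * (1 + ‖x‖) ^ k) ^ i := by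
    refine norm_iteratedFDeriv_comp_le (N := ((⊤ : ℕ∞) : WithTop ℕ∞))
      Complex.contDiff_exp hΦ.1 (mod_cast le_top) x ?_ ?_
    · intro j _
      rw [Complex.norm_iteratedFDeriv_real_exp, Complex.norm_exp]
      exact Real.exp_le_exp.2 (hre x)
    · intro j hj hji
      have h1x : (1 : ℝ) ≤ (1 + ‖x‖) ^ k := one_le_pow₀ (by simp)
      have hDx : (1 : ℝ) ≤ (1 + D) * (1 + ‖x‖) ^ k :=
        one_le_mul_of_one_le_of_one_le (by linarith) h1x
      calc ‖iteratedFDeriv ℝ j Φ x‖ ≤ D * (1 + ‖x‖) ^ k := hk j hji x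
        _ ≤ (1 + D) * (1 + ‖x‖) ^ k := by gcongr; simp
        _ ≤ _ := le_self_pow₀ hDx (by omega)
  have h2 : (1 + ‖x‖) ^ (m + k * i) ≤ (m + k * i).factorial * Real.exp (1 + ‖x‖) := by
    have := Real.pow_div_factorial_le_exp (1 + ‖x‖) (by positivity) (m + k * i)
    rwa [div_le_iff₀ (by positivity), mul_comm (Real.exp _)] at this
  have h3 : ‖x‖ ^ m ≤ (1 + ‖x‖) ^ m := by gcongr; simp
  calc ‖x‖ ^ m * ‖iteratedFDeriv ℝ i (fun x => Complex.exp (Φ x)) x‖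
      ≤ (1 + ‖x‖) ^ m * (i.factorial * Real.exp (C - ‖x‖) * ((1 + D) * (1 + ‖x‖) ^ k) ^ i) := by
        gcongr
        exact h1
    _ = (i.factorial * (1 + D) ^ i) * (Real.exp (C - ‖x‖) * (1 + ‖x‖) ^ (m + k * i)) := by
        rw [mul_pow, pow_add, pow_mul]; ring
    _ ≤ (i.factorial * (1 + D) ^ i) * (Real.exp (C - ‖x‖) *
          ((m + k * i).factorial * Real.exp (1 + ‖x‖))) := by gcongr
    _ = _ := by
        have : Real.exp (C + 1) = Real.exp (C - ‖x‖) * Real.exp (1 + ‖x‖) := by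
          rw [← Real.exp_add]; ring_nf
        rw [this]; ring

variable [FiniteDimensional ℝ V]

theorem hasTemperateGrowth_linear (ℓ : V →ₗ[ℝ] ℂ) : Function.HasTemperateGrowth (fun x => ℓ x) :=
  (LinearMap.toContinuousLinearMap ℓ).hasTemperateGrowth

theorem hasTemperateGrowth_quadratic (β : V →ₗ[ℝ] V →ₗ[ℝ] ℂ) :
    Function.HasTemperateGrowth (fun x => β x x) :=
  (LinearMap.toContinuousBilinearMap β).bilinear_hasTemperateGrowth (𝕜 := ℝ)
    Function.HasTemperateGrowth.id' Function.HasTemperateGrowth.id'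

/-- Compactness of the unit sphere and homogeneity of degree 2; the zero space is separate because
its unit sphere is empty. -/
theorem exists_mul_norm_sq_le_re (β : V →ₗ[ℝ] V →ₗ[ℝ] ℂ) (hβ : ∀ x, x ≠ 0 → 0 < (β x x).re) :
    ∃ ε : ℝ, 0 < ε ∧ ∀ x, ε * ‖x‖ ^ 2 ≤ (β x x).re := by
  have hcont : Continuous fun x => (β x x).re :=
    Complex.continuous_re.comp (hasTemperateGrowth_quadratic β).1.continuous
  rcases subsingleton_or_nontrivial V with hV | hV
  · exact ⟨1, one_pos, fun x => by simp [Subsingleton.elim x 0]⟩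
  obtain ⟨x₀, hx₀, hmin⟩ := (isCompact_sphere (0 : V) 1).exists_isMinOn
    (NormedSpace.sphere_nonempty.2 zero_le_one) hcont.continuousOn
  have hx₀' : x₀ ≠ 0 := by
    rintro rfl
    simp at hx₀
  refine ⟨(β x₀ x₀).re, hβ x₀ hx₀', fun x => ?_⟩
  rcases eq_or_ne x 0 with rfl | hx
  · simp
  have hn : ‖x‖ ≠ 0 := norm_ne_zero_iff.2 hx
  have h := hmin (show ‖x‖⁻¹ • x ∈ Metric.sphere (0 : V) 1 by simp [norm_smul, hn])
  have h2 : (β (‖x‖⁻¹ • x) (‖x‖⁻¹ • x)).re = (‖x‖ ^ 2)⁻¹ * (β x x).re := by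
    simp only [map_smul, LinearMap.smul_apply, Complex.real_smul, Complex.re_ofReal_mul]
    field_simp
  simp only [Set.mem_ofPred_eq, h2] at h
  have hp : 0 < ‖x‖ ^ 2 := by positivity
  calc (β x₀ x₀).re * ‖x‖ ^ 2 ≤ ((‖x‖ ^ 2)⁻¹ * (β x x).re) * ‖x‖ ^ 2 := by gcongr
    _ = _ := by field_simp

theorem exists_schwartz_gaussian (β : V →ₗ[ℝ] V →ₗ[ℝ] ℂ) (hβ : ∀ x, x ≠ 0 → 0 < (β x x).re)
    (κ : V →ₗ[ℝ] ℂ) : ∃ g : 𝓢(V, ℂ), ∀ x, g x = Complex.exp (-β x x + κ x) := by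
  obtain ⟨ε, hε, hle⟩ := exists_mul_norm_sq_le_re β hβ
  set K := ‖LinearMap.toContinuousLinearMap κ‖
  -- This is the maximum of (K + 1)t - εt²: K bounds the linear term and the extra 1 provides the
  -- required decay.
  refine exists_schwartz_cexp (C := (K + 1) ^ 2 / (4 * ε))
    ((hasTemperateGrowth_quadratic β).fun_neg.fun_add (hasTemperateGrowth_linear κ)) fun x => ?_
  have h1 : (κ x).re ≤ K * ‖x‖ :=
    (Complex.re_le_norm _).trans ((LinearMap.toContinuousLinearMap κ).le_opNorm x)
  have h2 := hle x
  have h3 : (K + 1) * ‖x‖ ≤ (K + 1) ^ 2 / (4 * ε) + ε * ‖x‖ ^ 2 := by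
    have : (K + 1) ^ 2 / (4 * ε) + ε * ‖x‖ ^ 2 - (K + 1) * ‖x‖
        = ((K + 1) - 2 * ε * ‖x‖) ^ 2 / (4 * ε) := by field_simp; ring
    have h4 : 0 ≤ ((K + 1) - 2 * ε * ‖x‖) ^ 2 / (4 * ε) := by positivity
    linarith
  simp only [Complex.add_re, Complex.neg_re]
  linarith

theorem hasFDerivAt_gaussian (β : V →ₗ[ℝ] V →ₗ[ℝ] ℂ) (hsymm : ∀ x y, β x y = β y x)
    (κ : V →ₗ[ℝ] ℂ) (x : V) :
    HasFDerivAt (fun x => Complex.exp (-β x x + κ x))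
      (Complex.exp (-β x x + κ x) • (-(2 : ℂ) • LinearMap.toContinuousLinearMap (β x)
        + LinearMap.toContinuousLinearMap κ)) x := by
  have h1 : HasFDerivAt (fun x => β x x) ((2 : ℂ) • LinearMap.toContinuousLinearMap (β x)) x := by
    have := (LinearMap.toContinuousBilinearMap β).hasFDerivAt_of_bilinear
      (hasFDerivAt_id x) (hasFDerivAt_id x)
    refine this.congr_fderiv ?_
    ext v
    simp [hsymm v x, two_mul]
  have h2 : HasFDerivAt (fun x => κ x) (LinearMap.toContinuousLinearMap κ) x :=
    (LinearMap.toContinuousLinearMap κ).hasFDerivAt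
  refine (h1.neg.add h2).cexp.congr_fderiv ?_
  ext v
  simp

variable [MeasurableSpace V] [BorelSpace V] (μ : Measure V) [μ.IsAddHaarMeasure]

theorem integrable_temperate_mul_gaussian {β : V →ₗ[ℝ] V →ₗ[ℝ] ℂ}
    (hβ : ∀ x, x ≠ 0 → 0 < (β x x).re) (κ : V →ₗ[ℝ] ℂ) {p : V → ℂ} (hp : p.HasTemperateGrowth) :
    Integrable (fun x => p x * Complex.exp (-β x x + κ x)) μ := by
  obtain ⟨g, hg⟩ := exists_schwartz_gaussian β hβ κ
  refine (SchwartzMap.integrable (μ := μ) (SchwartzMap.smulLeftCLM ℂ p g)).congr ?_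
  filter_upwards with x
  rw [SchwartzMap.smulLeftCLM_apply_apply hp, hg, smul_eq_mul]

theorem integrable_gaussian {β : V →ₗ[ℝ] V →ₗ[ℝ] ℂ}
    (hβ : ∀ x, x ≠ 0 → 0 < (β x x).re) (κ : V →ₗ[ℝ] ℂ) :
    Integrable (fun x => Complex.exp (-β x x + κ x)) μ := by
  simpa using integrable_temperate_mul_gaussian μ hβ κ (.const (1 : ℂ))

/-- Gaussian integration by parts against an affine function. -/
theorem integral_gaussian_by_parts {β : V →ₗ[ℝ] V →ₗ[ℝ] ℂ} (hsymm : ∀ x y, β x y = β y x)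
    (hβ : ∀ x, x ≠ 0 → 0 < (β x x).re) (κ : V →ₗ[ℝ] ℂ) (ℓ : V →ₗ[ℝ] ℂ) (a : ℂ) (w : V) :
    ∫ x, (2 * β w x - κ w) * (ℓ x + a) * Complex.exp (-β x x + κ x) ∂μ
      = ℓ w * ∫ x, Complex.exp (-β x x + κ x) ∂μ := by
  have hT : Function.HasTemperateGrowth fun x => ℓ x + a :=
    (hasTemperateGrowth_linear ℓ).fun_add (.const a)
  have hT' : Function.HasTemperateGrowth fun x => 2 * β w x - κ w :=
    ((Function.HasTemperateGrowth.const 2).fun_mul (hasTemperateGrowth_linear (β w))).fun_sub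
      (.const _)
  -- The derivative along w of (ℓ + a) exp(-β + κ) has integral zero.
  have key := integral_bilinear_hasFDerivAt_right_eq_neg_left_of_integrable (μ := μ) (v := w)
    (f := fun x => ℓ x + a) (f' := fun _ => LinearMap.toContinuousLinearMap ℓ)
    (g := fun x => Complex.exp (-β x x + κ x))
    (g' := fun x => Complex.exp (-β x x + κ x) • (-(2 : ℂ) • LinearMap.toContinuousLinearMap (β x)
        + LinearMap.toContinuousLinearMap κ)) (B := ContinuousLinearMap.mul ℝ ℂ)
    ?_ ?_ ?_ ?_ ?_
  · have h1 : ∀ x, (2 * β w x - κ w) * (ℓ x + a) * Complex.exp (-β x x + κ x)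
        = -((ContinuousLinearMap.mul ℝ ℂ (ℓ x + a)) ((Complex.exp (-β x x + κ x) •
          (-(2 : ℂ) • LinearMap.toContinuousLinearMap (β x)
            + LinearMap.toContinuousLinearMap κ)) w)) := by
      intro x
      simp [hsymm w x]
      ring
    simp_rw [h1]
    rw [integral_neg, key, neg_neg]
    simp [integral_const_mul]
  · simpa using (integrable_gaussian μ hβ κ).const_mul (ℓ w)
  · refine (integrable_temperate_mul_gaussian μ hβ κ (hT'.fun_mul hT).fun_neg).congr ?_
    filter_upwards with x
    simp [hsymm w x]
    ring
  · exact integrable_temperate_mul_gaussian μ hβ κ hT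
  · intro x _
    exact (LinearMap.toContinuousLinearMap ℓ).hasFDerivAt.add_const a
  · intro x _
    exact hasFDerivAt_gaussian β hsymm κ x

end GaussianIntegrals

/-! ### Symplectic linear algebra and the construction of A. -/

section Symplectic

open scoped ComplexOrder Matrix

variable {n : ℕ}

theorem symplForm_eq_dotProduct {𝕜 : Type} [CommRing 𝕜] (X Y : Phase n 𝕜) :
    symplForm X Y = X.1 ⬝ᵥ Y.2 - Y.1 ⬝ᵥ X.2 := by
  simp [symplForm, dotProduct, Finset.sum_sub_distrib]

/-- The symplectic form as a bilinear form. -/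
def symplBilin (n : ℕ) : LinearMap.BilinForm ℂ (Phase n ℂ) :=
  LinearMap.mk₂ ℂ symplForm
    (fun X X' Y => by simp [symplForm_eq_dotProduct]; ring)
    (fun c X Y => by simp [symplForm_eq_dotProduct]; ring)
    (fun X Y Y' => by simp [symplForm_eq_dotProduct]; ring)
    (fun c X Y => by simp [symplForm_eq_dotProduct]; ring)

/-- The standard symmetric bilinear form `P·R + Q·S` of `(P, Q)` and `(R, S)`. -/
def phaseDot {𝕜 : Type} [CommRing 𝕜] (n : ℕ) : LinearMap.BilinForm 𝕜 (Phase n 𝕜) :=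
  LinearMap.mk₂ 𝕜 (fun X Y => X.1 ⬝ᵥ Y.1 + X.2 ⬝ᵥ Y.2)
    (fun X X' Y => by simp; ring)
    (fun c X Y => by simp; ring)
    (fun X Y Y' => by simp; ring)
    (fun c X Y => by simp; ring)

/-- The standard complex structure `(P, Q) ↦ (-Q, P)`. -/
def phaseRot (n : ℕ) : Phase n ℂ →ₗ[ℂ] Phase n ℂ where
  toFun X := (-X.2, X.1)
  map_add' X Y := by simp; abel
  map_smul' c X := by simp

theorem symplBilin_apply (X Y : Phase n ℂ) : symplBilin n X Y = symplForm X Y := rfl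

theorem phaseDot_apply {𝕜 : Type} [CommRing 𝕜] (X Y : Phase n 𝕜) :
    phaseDot n X Y = X.1 ⬝ᵥ Y.1 + X.2 ⬝ᵥ Y.2 := rfl

theorem symplBilin_swap (X Y : Phase n ℂ) : symplBilin n X Y = -symplBilin n Y X := by
  simp [symplBilin_apply, symplForm_eq_dotProduct]

theorem phaseDot_comm {𝕜 : Type} [CommRing 𝕜] (X Y : Phase n 𝕜) :
    phaseDot n X Y = phaseDot n Y X := by
  simp [phaseDot_apply, dotProduct_comm]

theorem symplBilin_rot_right (X Y : Phase n ℂ) :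
    symplBilin n X (phaseRot n Y) = phaseDot n X Y := by
  simp [symplBilin_apply, symplForm_eq_dotProduct, phaseDot_apply, phaseRot, dotProduct_comm]

theorem symplBilin_rot_left (X Y : Phase n ℂ) :
    symplBilin n (phaseRot n X) Y = -phaseDot n X Y := by
  rw [symplBilin_swap, symplBilin_rot_right, phaseDot_comm]

theorem phaseDot_rot_left (X Y : Phase n ℂ) :
    phaseDot n (phaseRot n X) Y = symplBilin n X Y := by
  simp [symplBilin_apply, symplForm_eq_dotProduct, phaseDot_apply, phaseRot,
    dotProduct_comm X.2]
  ring

theorem star_phaseRot (X : Phase n ℂ) : star (phaseRot n X) = phaseRot n (star X) := by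
  ext <;> simp [phaseRot]

theorem star_symplBilin (X Y : Phase n ℂ) :
    star (symplBilin n X Y) = symplBilin n (star X) (star Y) := by
  simp [symplBilin_apply, symplForm]

theorem star_phaseDot (X Y : Phase n ℂ) :
    star (phaseDot n X Y) = phaseDot n (star X) (star Y) := by
  simp [phaseDot_apply, dotProduct]

theorem phaseDot_star_self_pos {X : Phase n ℂ} (hX : X ≠ 0) : 0 < phaseDot n X (star X) := by
  rw [phaseDot_apply]
  by_cases h1 : X.1 = 0
  · have h2 : X.2 ≠ 0 := fun h2 => hX (Prod.ext h1 h2)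
    exact add_pos_of_nonneg_of_pos (dotProduct_self_star_nonneg _)
      (Matrix.dotProduct_self_star_pos_iff.2 h2)
  · exact add_pos_of_pos_of_nonneg (Matrix.dotProduct_self_star_pos_iff.2 h1)
      (dotProduct_self_star_nonneg _)

theorem phaseDot_star_self_nonneg (X : Phase n ℂ) : 0 ≤ phaseDot n X (star X) :=
  add_nonneg (dotProduct_self_star_nonneg _) (dotProduct_self_star_nonneg _)

/-- Pairing X with J X* gives X·X*, which is positive for X ≠ 0. -/
theorem symplBilin_nondegenerate : (symplBilin n).Nondegenerate := by
  have h : ∀ X, (∀ Y, symplBilin n X Y = 0) → X = 0 := by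
    intro X hX
    by_contra h0
    have := phaseDot_star_self_pos h0
    rw [← symplBilin_rot_right, hX] at this
    exact lt_irrefl _ this
  exact ⟨h, fun X hX => h X fun Y => by rw [symplBilin_swap, hX, neg_zero]⟩

theorem symplBilin_isRefl : (symplBilin n).IsRefl := fun X Y h => by
  rw [symplBilin_swap, h, neg_zero]

theorem orthogonal_symplBilin (W : Submodule ℂ (Phase n ℂ)) :
    (symplBilin n).orthogonal W = skewOrth W := by
  ext Y
  rw [LinearMap.BilinForm.mem_orthogonal_iff]
  refine forall₂_congr fun X _ => ?_
  rw [symplBilin_swap, neg_eq_zero, symplBilin_apply]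

theorem mem_skewOrth {W : Submodule ℂ (Phase n ℂ)} {Y : Phase n ℂ} :
    Y ∈ skewOrth W ↔ ∀ X ∈ W, symplBilin n Y X = 0 := Iff.rfl

theorem skewOrth_skewOrth (W : Submodule ℂ (Phase n ℂ)) : skewOrth (skewOrth W) = W := by
  rw [← orthogonal_symplBilin, ← orthogonal_symplBilin]
  exact LinearMap.BilinForm.orthogonal_orthogonal symplBilin_nondegenerate symplBilin_isRefl W

theorem mem_conjSubspace {r : Submodule ℂ (Phase n ℂ)} {Y : Phase n ℂ} :
    Y ∈ conjSubspace r ↔ star Y ∈ r := Iff.rfl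

theorem skewOrth_conjSubspace (W : Submodule ℂ (Phase n ℂ)) :
    skewOrth (conjSubspace W) = conjSubspace (skewOrth W) := by
  ext Y
  simp only [mem_conjSubspace, mem_skewOrth]
  refine ⟨fun h X hX => ?_, fun h X hX => ?_⟩
  · have := h (star X) (by simpa using hX)
    rw [← star_eq_zero, star_symplBilin, star_star] at this
    exact this
  · have := h (star X) hX
    rw [← star_symplBilin, star_eq_zero] at this
    exact this

/-- Isotropy gives one inclusion, and the complement has dimension 2n - n = n. -/
theorem skewOrth_eq_self_of_isotropic {r : Submodule ℂ (Phase n ℂ)}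
    (hdim : Module.finrank ℂ r = n) (hiso : ∀ Y₁ ∈ r, ∀ Y₂ ∈ r, symplForm Y₁ Y₂ = 0) :
    skewOrth r = r := by
  symm
  refine Submodule.eq_of_le_of_finrank_eq (fun Y hY X hX => hiso Y hY X hX) ?_
  rw [← orthogonal_symplBilin, LinearMap.BilinForm.finrank_orthogonal symplBilin_nondegenerate,
    hdim]
  simp

theorem skewOrth_sup (U W : Submodule ℂ (Phase n ℂ)) :
    skewOrth (U ⊔ W) = skewOrth U ⊓ skewOrth W := by
  ext Y
  simp only [Submodule.mem_inf, mem_skewOrth]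
  refine ⟨fun h => ⟨fun X hX => h X (Submodule.mem_sup_left hX),
    fun X hX => h X (Submodule.mem_sup_right hX)⟩, fun h X hX => ?_⟩
  obtain ⟨u, hu, w, hw, rfl⟩ := Submodule.mem_sup.1 hX
  rw [map_add, h.1 u hu, h.2 w hw, add_zero]

theorem Phase.toComplex_add (X Y : Phase n ℝ) :
    (X + Y).toComplex = X.toComplex + Y.toComplex := by
  ext <;> simp [Phase.toComplex]

theorem Phase.toComplex_smul (c : ℝ) (X : Phase n ℝ) :
    (c • X).toComplex = (c : ℂ) • X.toComplex := by
  ext <;> simp [Phase.toComplex]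

theorem Phase.star_toComplex (X : Phase n ℝ) : star X.toComplex = X.toComplex := by
  ext <;> simp [Phase.toComplex]

theorem toComplex_mem_complexify {L : Submodule ℝ (Phase n ℝ)} {X : Phase n ℝ} (hX : X ∈ L) :
    X.toComplex ∈ complexify L :=
  Submodule.subset_span ⟨X, hX, rfl⟩

theorem exists_of_mem_complexify {L : Submodule ℝ (Phase n ℝ)} {Y : Phase n ℂ}
    (hY : Y ∈ complexify L) :
    ∃ X₁ ∈ L, ∃ X₂ ∈ L, Y = X₁.toComplex + Complex.I • X₂.toComplex := by
  induction hY using Submodule.span_induction with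
  | mem Y h =>
    obtain ⟨X, hX, rfl⟩ := h
    exact ⟨X, hX, 0, L.zero_mem, by ext <;> simp [Phase.toComplex]⟩
  | zero => exact ⟨0, L.zero_mem, 0, L.zero_mem, by ext <;> simp [Phase.toComplex]⟩
  | add Y Z _ _ hY hZ =>
    obtain ⟨X₁, h₁, X₂, h₂, rfl⟩ := hY
    obtain ⟨X₃, h₃, X₄, h₄, rfl⟩ := hZ
    refine ⟨X₁ + X₃, L.add_mem h₁ h₃, X₂ + X₄, L.add_mem h₂ h₄, ?_⟩
    simp only [Phase.toComplex_add, smul_add]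
    abel
  | smul c Y _ hY =>
    obtain ⟨X₁, h₁, X₂, h₂, rfl⟩ := hY
    refine ⟨c.re • X₁ - c.im • X₂, L.sub_mem (L.smul_mem _ h₁) (L.smul_mem _ h₂),
      c.re • X₂ + c.im • X₁, L.add_mem (L.smul_mem _ h₂) (L.smul_mem _ h₁), ?_⟩
    ext j <;> simp [Phase.toComplex] <;> conv_lhs => rw [← Complex.re_add_im c]
    all_goals
      ring_nf
      simp only [Complex.I_sq]
      ring

theorem star_mem_complexify {L : Submodule ℝ (Phase n ℝ)} {Y : Phase n ℂ}
    (hY : Y ∈ complexify L) : star Y ∈ complexify L := by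
  obtain ⟨X₁, h₁, X₂, h₂, rfl⟩ := exists_of_mem_complexify hY
  rw [star_add, star_smul, Phase.star_toComplex, Phase.star_toComplex]
  exact add_mem (toComplex_mem_complexify h₁)
    (Submodule.smul_mem _ _ (toComplex_mem_complexify h₂))

/-- The bilinear dot product has null vectors over ℂ, but L^ℂ is stable under conjugation: a vector
of L^ℂ orthogonal to L^ℂ satisfies X·X* = 0, hence vanishes. -/
theorem isCompl_complexify_orthogonal (L : Submodule ℝ (Phase n ℝ)) :
    IsCompl (complexify L) ((phaseDot n).orthogonal (complexify L)) := by
  refine (LinearMap.BilinForm.isCompl_orthogonal_iff_disjoint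
    fun X Y h => by rw [phaseDot_comm, h]).2 (Submodule.disjoint_def.2 fun X hX hX' => ?_)
  by_contra h0
  have := phaseDot_star_self_pos h0
  rw [phaseDot_comm, LinearMap.BilinForm.mem_orthogonal_iff.1 hX' _ (star_mem_complexify hX)]
    at this
  exact lt_irrefl _ this

/-- A positive Lagrangian subspace is the graph of a symmetric matrix with positive definite
imaginary part. -/
theorem exists_matrix_of_positive_lagrangian {R : Submodule ℂ (Phase n ℂ)}
    (hdim : Module.finrank ℂ R = n) (hiso : ∀ Y₁ ∈ R, ∀ Y₂ ∈ R, symplBilin n Y₁ Y₂ = 0)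
    (hpos : ∀ Y ∈ R, Y ≠ 0 → 0 < (1 / Complex.I) * symplBilin n Y (star Y)) :
    ∃ A : Matrix (Fin n) (Fin n) ℂ, A.IsSymm ∧ (A.map Complex.im).PosDef ∧
      ∀ Y, Y ∈ R ↔ Y.1 = A *ᵥ Y.2 := by
  let π₂ : R →ₗ[ℂ] (Fin n → ℂ) := (LinearMap.snd ℂ _ _).comp R.subtype
  -- A vector with Q = 0 has ω(Y,Y*) = 0, so positivity excludes nonzero ones; equal dimensions then
  -- make the projection to Q an isomorphism.
  have hinj : Function.Injective π₂ := by
    rw [← LinearMap.ker_eq_bot, LinearMap.ker_eq_bot']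
    rintro ⟨Y, hY⟩ h0
    have h2 : Y.2 = 0 := h0
    by_contra hne
    have hY0 : Y ≠ 0 := fun h => hne (Subtype.ext h)
    have := hpos Y hY hY0
    rw [symplBilin_apply, symplForm_eq_dotProduct] at this
    simp [h2] at this
  let e : R ≃ₗ[ℂ] (Fin n → ℂ) := LinearEquiv.ofInjectiveOfFinrankEq π₂ hinj (by simp [hdim])
  let f : (Fin n → ℂ) →ₗ[ℂ] (Fin n → ℂ) :=
    ((LinearMap.fst ℂ _ _).comp R.subtype).comp e.symm.toLinearMap
  have hmem : ∀ q : Fin n → ℂ, ((LinearMap.toMatrix' f) *ᵥ q, q) ∈ R := by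
    intro q
    have h2 : (e.symm q : Phase n ℂ).2 = q := e.apply_symm_apply q
    have h1 : (LinearMap.toMatrix' f) *ᵥ q = (e.symm q : Phase n ℂ).1 := by
      rw [LinearMap.toMatrix'_mulVec]; rfl
    rw [h1]
    nth_rewrite 2 [← h2]
    exact (e.symm q).2
  have hmem' : ∀ Y, Y ∈ R ↔ Y.1 = (LinearMap.toMatrix' f) *ᵥ Y.2 := by
    intro Y
    refine ⟨fun hY => ?_, fun hY => ?_⟩
    · have : (⟨Y, hY⟩ : R) = ⟨_, hmem Y.2⟩ := hinj rfl
      exact congrArg Prod.fst (congrArg Subtype.val this)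
    · have := hmem Y.2
      rwa [← hY] at this
  set A := LinearMap.toMatrix' f
  have hsymm : A.IsSymm := by
    ext i j
    have := hiso _ (hmem (Pi.single i 1)) _ (hmem (Pi.single j 1))
    rw [symplBilin_apply, symplForm_eq_dotProduct] at this
    simp [sub_eq_zero] at this
    simpa using this
  refine ⟨A, hsymm, ?_, hmem'⟩
  refine Matrix.PosDef.of_dotProduct_mulVec_pos ?_ fun x hx => ?_
  · ext i j
    simp [hsymm.apply i j]
  · have hne : ((A *ᵥ fun j => (x j : ℂ)), fun j => (x j : ℂ)) ≠ (0 : Phase n ℂ) := by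
      intro h
      apply hx
      ext j
      have := congrFun (congrArg Prod.snd h) j
      simpa using this
    have h := hpos _ (hmem _) hne
    rw [symplBilin_apply, symplForm_eq_dotProduct] at h
    have h' := (Complex.lt_def.1 h).1
    have hval : ((1 / Complex.I) * ((A *ᵥ fun j => (x j : ℂ)) ⬝ᵥ star (fun j => (x j : ℂ))
        - star (A *ᵥ fun j => (x j : ℂ)) ⬝ᵥ fun j => (x j : ℂ))).re
        = 2 * (star x ⬝ᵥ (A.map Complex.im *ᵥ x)) := by
      simp [dotProduct, Matrix.mulVec, Finset.mul_sum, Finset.sum_mul]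
      simp only [← Finset.sum_add_distrib]
      exact Finset.sum_congr rfl fun i _ => Finset.sum_congr rfl fun j _ => by ring
    have h'' : 0 < 2 * (star x ⬝ᵥ (A.map Complex.im *ᵥ x)) := by
      rw [← hval]; exact h'
    linarith

/-! ### The subspace r: its relation to L^ℂ and its positive deformation. -/

section Polarization

variable {L : Submodule ℝ (Phase n ℝ)} {r : Submodule ℂ (Phase n ℂ)}

theorem inf_conjSubspace_eq_complexify
    (hiso : ∀ Y₁ ∈ r, ∀ Y₂ ∈ r, symplForm Y₁ Y₂ = 0) (hLr : complexify L ≤ r)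
    (hpos : ∀ Y ∈ r, Y ∉ complexify L → 0 < (1 / Complex.I) * symplForm Y (star Y)) :
    r ⊓ conjSubspace r = complexify L := by
  refine le_antisymm (fun Y hY => ?_) fun Y hY => ⟨hLr hY, hLr (star_mem_complexify hY)⟩
  by_contra h
  have := hpos Y hY.1 h
  rw [hiso Y hY.1 _ hY.2, mul_zero] at this
  exact lt_irrefl _ this

theorem skewOrth_eq_sup_conjSubspace (hdim : Module.finrank ℂ r = n)
    (hiso : ∀ Y₁ ∈ r, ∀ Y₂ ∈ r, symplForm Y₁ Y₂ = 0)
    (hinf : r ⊓ conjSubspace r = complexify L) :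
    skewOrth (complexify L) = r ⊔ conjSubspace r := by
  have hr := skewOrth_eq_self_of_isotropic hdim hiso
  rw [← skewOrth_skewOrth (r ⊔ conjSubspace r), skewOrth_sup, skewOrth_conjSubspace, hr, hinf]

/-- A subspace `r` which is non-negative, with null space the complexification of `L`, can be
deformed to a positive Lagrangian subspace which agrees with `r` on the orthogonal complement
of `L`. -/
theorem exists_matrix_of_nonneg_lagrangian (hdim : Module.finrank ℂ r = n)
    (hiso : ∀ Y₁ ∈ r, ∀ Y₂ ∈ r, symplForm Y₁ Y₂ = 0) (hLr : complexify L ≤ r)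
    (hpos : ∀ Y ∈ r, Y ∉ complexify L → 0 < (1 / Complex.I) * symplForm Y (star Y)) :
    ∃ A : Matrix (Fin n) (Fin n) ℂ, A.IsSymm ∧ (A.map Complex.im).PosDef ∧
      (∀ X ∈ complexify L, (X - Complex.I • phaseRot n X).1
        = A *ᵥ (X - Complex.I • phaseRot n X).2) ∧
      ∀ W ∈ r, (∀ X ∈ complexify L, phaseDot n W X = 0) → W.1 = A *ᵥ W.2 := by
  have hc := isCompl_complexify_orthogonal L
  let π : Phase n ℂ →ₗ[ℂ] Phase n ℂ :=
    (complexify L).projection _ hc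
  have hπmem : ∀ Y, π Y ∈ complexify L := fun Y => Submodule.projection_apply_mem hc Y
  have hπid : ∀ Y ∈ complexify L, π Y = Y := fun Y hY =>
    Submodule.projection_apply_left hc ⟨Y, hY⟩
  have hπzero : ∀ Y, (∀ X ∈ complexify L, phaseDot n Y X = 0) → π Y = 0 := fun Y hY =>
    Submodule.projection_apply_of_mem_right hc
      (LinearMap.BilinForm.mem_orthogonal_iff.2 fun X hX => by rw [phaseDot_comm]; exact hY X hX)
  have hπorth : ∀ Y, ∀ X ∈ complexify L, phaseDot n (Y - π Y) X = 0 := by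
    intro Y X hX
    have h : Y - π Y ∈ (phaseDot n).orthogonal (complexify L) := by
      rw [← Submodule.projection_apply_eq_zero_iff hc, map_sub, sub_eq_zero]
      exact (hπid _ (hπmem Y)).symm
    rw [phaseDot_comm]
    exact LinearMap.BilinForm.mem_orthogonal_iff.1 h X hX
  have hdotπ : ∀ Y, ∀ X ∈ complexify L, phaseDot n Y X = phaseDot n (π Y) X := by
    intro Y X hX
    have := hπorth Y X hX
    rw [map_sub, LinearMap.sub_apply, sub_eq_zero] at this
    exact this
  -- T sends X + W to X - iJX + W, with X in L^ℂ and W orthogonal to it.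
  let T : Phase n ℂ →ₗ[ℂ] Phase n ℂ := LinearMap.id - Complex.I • (phaseRot n).comp π
  have hT : ∀ Y, T Y = Y - Complex.I • phaseRot n (π Y) := fun Y => rfl
  -- The two cross terms are ∓i πY₁·πY₂ and cancel; the J, J term is a multiple of ω(πY₁, πY₂) = 0.
  have hTiso : ∀ Y₁ ∈ r, ∀ Y₂ ∈ r, symplBilin n (T Y₁) (T Y₂) = 0 := by
    intro Y₁ h₁ Y₂ h₂
    have e1 : symplBilin n Y₁ Y₂ = 0 := hiso Y₁ h₁ Y₂ h₂
    have e2 : symplBilin n (π Y₁) (π Y₂) = 0 := hiso _ (hLr (hπmem _)) _ (hLr (hπmem _))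
    simp only [hT, map_sub, LinearMap.sub_apply, map_smul, LinearMap.smul_apply,
      symplBilin_rot_left, symplBilin_rot_right, phaseDot_rot_left, e1, e2, smul_eq_mul,
      hdotπ Y₁ _ (hπmem Y₂), phaseDot_comm (π Y₁) Y₂, hdotπ Y₂ _ (hπmem Y₁),
      phaseDot_comm (π Y₂) (π Y₁)]
    ring
  have hTpos : ∀ Y ∈ r, Y ≠ 0 → 0 < (1 / Complex.I) * symplBilin n (T Y) (star (T Y)) := by
    intro Y hY hY0
    obtain ⟨X, hX⟩ : ∃ X, X = π Y := ⟨_, rfl⟩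
    obtain ⟨W, hW⟩ : ∃ W, W = Y - π Y := ⟨_, rfl⟩
    have hXL : X ∈ complexify L := hX ▸ hπmem Y
    have hXL' := star_mem_complexify hXL
    have hWr : W ∈ r := hW ▸ r.sub_mem hY (hLr (hπmem Y))
    have hYeq : Y = X + W := by rw [hX, hW]; abel
    have hWX : ∀ Z ∈ complexify L, phaseDot n W Z = 0 := hW ▸ hπorth Y
    have hWX' : ∀ Z ∈ complexify L, phaseDot n Z (star W) = 0 := by
      intro Z hZ
      rw [← star_eq_zero, star_phaseDot, star_star, phaseDot_comm]
      exact hWX _ (star_mem_complexify hZ)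
    have e1 : symplBilin n X (star X) = 0 := hiso _ (hLr hXL) _ (hLr hXL')
    have e2 : symplBilin n W (star X) = 0 := hiso _ hWr _ (hLr hXL')
    have e3 : symplBilin n X (star W) = 0 := by
      rw [← star_eq_zero, star_symplBilin, star_star, symplBilin_swap, neg_eq_zero]
      exact hiso _ hWr _ (hLr hXL')
    -- Conjugation flips the sign of one i, so the cross terms that cancelled for isotropy now add
    -- up to 2 X·X*.
    have hval : (1 / Complex.I) * symplBilin n (T Y) (star (T Y))
        = 2 * phaseDot n X (star X) + (1 / Complex.I) * symplBilin n W (star W) := by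
      have hTY : T Y = X + W - Complex.I • phaseRot n X := by rw [hT, ← hX, hYeq]
      rw [hTY]
      simp only [star_sub, star_add, star_smul, star_phaseRot, map_sub, map_add,
        LinearMap.sub_apply, LinearMap.add_apply, map_smul, LinearMap.smul_apply,
        symplBilin_rot_left, symplBilin_rot_right, phaseDot_rot_left, e1, e2, e3, smul_eq_mul,
        hWX _ hXL', hWX' _ hXL]
      simp
      linear_combination (-2 * phaseDot n X (star X)) * Complex.I_sq
    rw [hval]
    by_cases hWL : W ∈ complexify L
    · have hW0 : W = 0 := by
        by_contra h0
        have := phaseDot_star_self_pos h0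
        rw [hWX _ (star_mem_complexify hWL)] at this
        exact lt_irrefl _ this
      have hX0 : X ≠ 0 := by
        rintro rfl
        exact hY0 (by rw [hYeq, hW0, add_zero])
      simpa [hW0] using phaseDot_star_self_pos hX0
    · exact add_pos_of_nonneg_of_pos
        (mul_nonneg zero_le_two (phaseDot_star_self_nonneg X)) (hpos W hWr hWL)
  have hTinj : Function.Injective (T.domRestrict r) := by
    rw [← LinearMap.ker_eq_bot, LinearMap.ker_eq_bot']
    rintro ⟨Y, hY⟩ h0
    by_contra hne
    have h := hTpos Y hY fun h => hne (Subtype.ext h)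
    have h0' : T Y = 0 := h0
    simp [h0'] at h
  obtain ⟨A, hA, hA', hgraph⟩ := exists_matrix_of_positive_lagrangian (R := r.map T)
    (by
      rw [← LinearMap.range_domRestrict, LinearMap.finrank_range_of_inj hTinj, hdim])
    (by
      rintro _ ⟨Y₁, h₁, rfl⟩ _ ⟨Y₂, h₂, rfl⟩
      exact hTiso _ h₁ _ h₂)
    (by
      rintro _ ⟨Y, h, rfl⟩ h0
      exact hTpos _ h fun h' => h0 (by rw [h', map_zero]))
  refine ⟨A, hA, hA', fun X hX => (hgraph _).1 ⟨X, hLr hX, ?_⟩, fun W hW h => (hgraph _).1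
    ⟨W, hW, ?_⟩⟩
  · rw [hT, hπid X hX]
  · rw [hT, hπzero W h]
    simp

theorem exists_add_orthogonal (hLr : complexify L ≤ r) {Y : Phase n ℂ} (hY : Y ∈ r) :
    ∃ X ∈ complexify L, ∃ W ∈ r, (∀ X' ∈ complexify L, phaseDot n W X' = 0) ∧ Y = X + W := by
  obtain ⟨X, hX, W, hW, rfl⟩ := Submodule.mem_sup.1
    ((isCompl_complexify_orthogonal L).sup_eq_top ▸ Submodule.mem_top (x := Y))
  refine ⟨X, hX, W, ?_, fun X' hX' => ?_, rfl⟩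
  · simpa using r.sub_mem hY (hLr hX)
  · rw [phaseDot_comm]
    exact LinearMap.BilinForm.mem_orthogonal_iff.1 hW X' hX'

end Polarization

end Symplectic

/-! ### Gaussian integrals over ξ and matrix elements of Gaussian states. -/

section GaussianStates

open MeasureTheory
open scoped Matrix ComplexOrder

variable {n : ℕ}

/-- Positivity in the order of ℂ makes β real on the diagonal, so the integrand is a positive real
function. -/
theorem integral_gaussian_ne_zero {V : Type*} [NormedAddCommGroup V] [NormedSpace ℝ V]
    [FiniteDimensional ℝ V] [MeasurableSpace V] [BorelSpace V] (μ : Measure V)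
    [μ.IsAddHaarMeasure] {β : V →ₗ[ℝ] V →ₗ[ℝ] ℂ} (hβ : ∀ x, x ≠ 0 → 0 < β x x) :
    ∫ x, Complex.exp (-β x x) ∂μ ≠ 0 := by
  have him : ∀ x, β x x = ((β x x).re : ℂ) := fun x => by
    rcases eq_or_ne x 0 with rfl | hx
    · simp
    · exact Complex.ext (by simp) (by simpa using (Complex.lt_def.1 (hβ x hx)).2.symm)
  have hintg := (integrable_gaussian μ (fun x hx => (Complex.lt_def.1 (hβ x hx)).1) 0).re
  have hexp : ∀ x, Complex.exp (-β x x) = ((Real.exp (-(β x x).re) : ℝ) : ℂ) := fun x => by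
    rw [Complex.ofReal_exp, Complex.ofReal_neg, ← him x]
  simp only [LinearMap.zero_apply, add_zero, hexp] at hintg ⊢
  rw [integral_complex_ofReal]
  exact_mod_cast ne_of_gt (integral_exp_pos hintg)

/-- Real vectors regarded as complex ones. -/
def ofRealVec (n : ℕ) : (Fin n → ℝ) →ₗ[ℝ] (Fin n → ℂ) where
  toFun x j := (x j : ℂ)
  map_add' x y := by ext; simp
  map_smul' c x := by ext; simp

theorem ofRealVec_apply (x : Fin n → ℝ) (j : Fin n) : ofRealVec n x j = (x j : ℂ) := rfl

theorem star_ofRealVec (x : Fin n → ℝ) : star (ofRealVec n x) = ofRealVec n x := by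
  ext; simp [ofRealVec_apply]

theorem exists_ofRealVec_add (w : Fin n → ℂ) :
    ∃ w₁ w₂, w = ofRealVec n w₁ + Complex.I • ofRealVec n w₂ :=
  ⟨fun j => (w j).re, fun j => (w j).im, by
    ext j; simp [ofRealVec_apply, mul_comm Complex.I]⟩

/-- The complex bilinear form `x·A y` of a matrix, on real vectors. -/
noncomputable def realBilin (A : Matrix (Fin n) (Fin n) ℂ) :
    (Fin n → ℝ) →ₗ[ℝ] (Fin n → ℝ) →ₗ[ℝ] ℂ :=
  LinearMap.mk₂ ℝ (fun x y => ofRealVec n x ⬝ᵥ A *ᵥ ofRealVec n y)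
    (fun x x' y => by simp) (fun c x y => by simp)
    (fun x y y' => by simp [Matrix.mulVec_add]) (fun c x y => by simp [Matrix.mulVec_smul])

theorem realBilin_apply (A : Matrix (Fin n) (Fin n) ℂ) (x y : Fin n → ℝ) :
    realBilin A x y = ofRealVec n x ⬝ᵥ A *ᵥ ofRealVec n y := rfl

theorem dotProduct_mulVec_symm {A : Matrix (Fin n) (Fin n) ℂ} (hA : A.IsSymm)
    (x y : Fin n → ℂ) : x ⬝ᵥ A *ᵥ y = y ⬝ᵥ A *ᵥ x := by
  rw [Matrix.dotProduct_mulVec, ← Matrix.mulVec_transpose, hA.eq, dotProduct_comm]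

theorem realBilin_symm {A : Matrix (Fin n) (Fin n) ℂ} (hA : A.IsSymm) (x y : Fin n → ℝ) :
    realBilin A x y = realBilin A y x := dotProduct_mulVec_symm hA _ _

/-- The complexification of a real matrix. -/
abbrev ofRealMat (B : Matrix (Fin n) (Fin n) ℝ) : Matrix (Fin n) (Fin n) ℂ := B.map Complex.ofReal

theorem realBilin_ofRealMat (B : Matrix (Fin n) (Fin n) ℝ) (x y : Fin n → ℝ) :
    realBilin (ofRealMat B) x y = ((x ⬝ᵥ B *ᵥ y : ℝ) : ℂ) := by
  simp [realBilin_apply, dotProduct, Matrix.mulVec, ofRealVec_apply]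

theorem realBilin_ofRealMat_pos {B : Matrix (Fin n) (Fin n) ℝ} (hB : B.PosDef) (x : Fin n → ℝ)
    (hx : x ≠ 0) : 0 < realBilin (ofRealMat B) x x := by
  rw [realBilin_ofRealMat]
  have := hB.dotProduct_mulVec_pos hx
  simp only [star_trivial] at this
  exact_mod_cast this

theorem star_ofRealMat_mulVec (B : Matrix (Fin n) (Fin n) ℝ) (x : Fin n → ℂ) :
    star (ofRealMat B *ᵥ x) = ofRealMat B *ᵥ star x := by
  ext i; simp [Matrix.mulVec, dotProduct]

theorem isSymm_ofRealMat {B : Matrix (Fin n) (Fin n) ℝ} (hB : B.PosDef) :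
    (ofRealMat B).IsSymm := by
  ext i j
  have := hB.isHermitian.apply i j
  simpa using this

/-- The real linear functional `ξ ↦ v·ξ` of a complex vector. -/
noncomputable def realFunctional (v : Fin n → ℂ) : (Fin n → ℝ) →ₗ[ℝ] ℂ where
  toFun x := v ⬝ᵥ ofRealVec n x
  map_add' x y := by simp
  map_smul' c x := by simp

theorem realFunctional_apply (v : Fin n → ℂ) (x : Fin n → ℝ) :
    realFunctional v x = v ⬝ᵥ ofRealVec n x := rfl

theorem exists_transpose_mul_self {B : Matrix (Fin n) (Fin n) ℝ} (hB : B.PosDef) :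
    ∃ S : Matrix (Fin n) (Fin n) ℝ, S.det ≠ 0 ∧ B = Sᵀ * S := by
  open scoped MatrixOrder Matrix.Norms.L2Operator in
  have h0 : 0 ≤ B := Matrix.nonneg_iff_posSemidef.2 hB.posSemidef
  have hS : CFC.sqrt B * CFC.sqrt B = B := CFC.sqrt_mul_sqrt_self B h0
  have hT : (CFC.sqrt B)ᵀ = CFC.sqrt B := by
    have : (CFC.sqrt B)ᴴ = CFC.sqrt B := (CFC.sqrt_nonneg B).isSelfAdjoint
    rwa [Matrix.conjTranspose_eq_transpose_of_trivial] at this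
  refine ⟨CFC.sqrt B, fun h => ?_, by rw [hT, hS]⟩
  have := hB.det_pos
  rw [← hS, Matrix.det_mul, h] at this
  simp at this

theorem integral_comp_toLin (S : Matrix (Fin n) (Fin n) ℝ) (hS : S.det ≠ 0) {F : (Fin n → ℝ) → ℂ}
    (hF : Continuous F) :
    ∫ x, F (S *ᵥ x) = ((|S.det⁻¹| : ℝ) : ℂ) * ∫ x, F x := by
  have h := Real.map_matrix_volume_pi_eq_smul_volume_pi hS
  have h2 := integral_map (μ := (volume : Measure (Fin n → ℝ))) (φ := Matrix.toLin' S)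
    (LinearMap.continuous_of_finiteDimensional _).aemeasurable (f := F) hF.aestronglyMeasurable
  rw [h, integral_smul_measure] at h2
  simpa using h2.symm

/-- The Gaussian integral with a complex linear term. -/
theorem integral_gaussian_eq {B : Matrix (Fin n) (Fin n) ℝ} (hB : B.PosDef) (p : Fin n → ℂ) :
    ∫ x : Fin n → ℝ, Complex.exp (-realBilin (ofRealMat B) x x
        + realFunctional ((2 : ℂ) • ofRealMat B *ᵥ p) x)
      = (∫ x : Fin n → ℝ, Complex.exp (-realBilin (ofRealMat B) x x))
        * Complex.exp (p ⬝ᵥ ofRealMat B *ᵥ p) := by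
  obtain ⟨S, hS, rfl⟩ := exists_transpose_mul_self hB
  have hmul : ∀ x y : Fin n → ℂ, x ⬝ᵥ ofRealMat (Sᵀ * S) *ᵥ y
      = (ofRealMat S *ᵥ x) ⬝ᵥ (ofRealMat S *ᵥ y) := by
    intro x y
    have : ofRealMat (Sᵀ * S) = (ofRealMat S)ᵀ * ofRealMat S := by
      exact Matrix.map_mul (f := Complex.ofRealHom)
    rw [this, ← Matrix.mulVec_mulVec, Matrix.mulVec_transpose, dotProduct_comm,
      ← Matrix.dotProduct_mulVec, dotProduct_comm]
  have hvec : ∀ x, ofRealMat S *ᵥ ofRealVec n x = ofRealVec n (S *ᵥ x) := by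
    intro x; ext i; simp [Matrix.mulVec, dotProduct, ofRealVec_apply]
  -- The substitution y = Sx reduces to the standard Gaussian. Taking q = 0 identifies the
  -- normalising constant.
  have key : ∀ q : Fin n → ℂ, ∫ x : Fin n → ℝ, Complex.exp (-realBilin (ofRealMat (Sᵀ * S)) x x
        + realFunctional ((2 : ℂ) • ofRealMat (Sᵀ * S) *ᵥ q) x)
      = ((|S.det⁻¹| : ℝ) : ℂ) * ((Real.pi / 1 : ℂ) ^ (Fintype.card (Fin n) / 2 : ℂ)
        * Complex.exp (q ⬝ᵥ ofRealMat (Sᵀ * S) *ᵥ q)) := by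
    intro q
    have h1 := GaussianFourier.integral_cexp_neg_mul_sum_add (b := 1) (by simp)
      ((2 : ℂ) • ofRealMat S *ᵥ q)
    have h2 : (∑ i, ((2 : ℂ) • ofRealMat S *ᵥ q) i ^ 2) / (4 * 1)
        = q ⬝ᵥ ofRealMat (Sᵀ * S) *ᵥ q := by
      rw [hmul, dotProduct, mul_one, Finset.sum_div]
      exact Finset.sum_congr rfl fun i _ => by simp; ring
    rw [h2] at h1
    rw [← h1, ← integral_comp_toLin S hS (by fun_prop)]
    refine integral_congr_ae (Filter.Eventually.of_forall fun x => ?_)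
    dsimp only
    congr 1
    rw [realBilin_apply, realFunctional_apply, hmul, hvec, smul_dotProduct,
      dotProduct_comm (_ *ᵥ q), hmul, hvec]
    simp [dotProduct, ofRealVec_apply, Finset.mul_sum, pow_two]
    exact Finset.sum_congr rfl fun i _ => by ring
  have h0 := key 0
  simp only [Matrix.mulVec_zero, smul_zero, dotProduct_zero, Complex.exp_zero, mul_one] at h0
  simp only [realFunctional_apply, zero_dotProduct, add_zero] at h0
  rw [key, h0]
  ring

/-- Gaussian integration by parts in a complex direction. -/
theorem integral_gaussian_by_parts_complex {B : Matrix (Fin n) (Fin n) ℝ} (hB : B.PosDef)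
    (p w z : Fin n → ℂ) (a : ℂ) :
    ∫ x : Fin n → ℝ, (2 * (w ⬝ᵥ ofRealMat B *ᵥ ofRealVec n x) - 2 * (w ⬝ᵥ ofRealMat B *ᵥ p))
        * (z ⬝ᵥ ofRealVec n x + a) * Complex.exp (-realBilin (ofRealMat B) x x
          + realFunctional ((2 : ℂ) • ofRealMat B *ᵥ p) x)
      = z ⬝ᵥ w * ∫ x : Fin n → ℝ, Complex.exp (-realBilin (ofRealMat B) x x
          + realFunctional ((2 : ℂ) • ofRealMat B *ᵥ p) x) := by
  have hpos : ∀ x, x ≠ 0 → 0 < (realBilin (ofRealMat B) x x).re := fun x hx =>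
    (Complex.lt_def.1 (realBilin_ofRealMat_pos hB x hx)).1
  have hreal := fun w => integral_gaussian_by_parts volume
    (realBilin_symm (isSymm_ofRealMat hB)) hpos (realFunctional ((2 : ℂ) • ofRealMat B *ᵥ p))
    (realFunctional z) a w
  have hintg := fun w => integrable_temperate_mul_gaussian volume hpos
    (realFunctional ((2 : ℂ) • ofRealMat B *ᵥ p))
    ((((Function.HasTemperateGrowth.const (2 : ℂ)).fun_mul
      (hasTemperateGrowth_linear (realBilin (ofRealMat B) w))).fun_sub
      (.const (realFunctional ((2 : ℂ) • ofRealMat B *ᵥ p) w))).fun_mul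
      ((hasTemperateGrowth_linear (realFunctional z)).fun_add (.const a)))
  -- Both sides are complex linear in w, so real directions suffice.
  obtain ⟨w₁, w₂, rfl⟩ := exists_ofRealVec_add w
  have hpw : ∀ w, realFunctional ((2 : ℂ) • ofRealMat B *ᵥ p) w
      = 2 * (ofRealVec n w ⬝ᵥ ofRealMat B *ᵥ p) := by
    intro w
    rw [realFunctional_apply, smul_dotProduct, dotProduct_comm, smul_eq_mul]
  have hsum := integral_add (hintg w₁) ((hintg w₂).const_mul Complex.I)
  rw [integral_const_mul, hreal, hreal] at hsum
  rw [dotProduct_add, dotProduct_smul, smul_eq_mul]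
  simp only [realFunctional_apply z] at hsum
  rw [add_mul, mul_assoc Complex.I, ← hsum]
  refine integral_congr_ae (Filter.Eventually.of_forall fun x => ?_)
  dsimp only
  rw [hpw w₁, hpw w₂, realBilin_apply _ w₁, realBilin_apply _ w₂, add_dotProduct,
    add_dotProduct, smul_dotProduct, smul_dotProduct]
  simp only [smul_eq_mul]
  ring

variable {A : Matrix (Fin n) (Fin n) ℂ}

theorem mulVec_sub_star_mulVec (A : Matrix (Fin n) (Fin n) ℂ) (x : Fin n → ℂ) :
    A *ᵥ x - star (A *ᵥ star x) = (2 * Complex.I) • ofRealMat (A.map Complex.im) *ᵥ x := by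
  ext i
  simp only [Matrix.mulVec, dotProduct, Pi.sub_apply, Pi.star_apply, star_sum, star_mul',
    star_star, Pi.smul_apply, smul_eq_mul, Finset.mul_sum, ← Finset.sum_sub_distrib,
    Matrix.map_apply]
  refine Finset.sum_congr rfl fun j _ => ?_
  have h : A i j - star (A i j) = 2 * Complex.I * ((A i j).im : ℂ) := by
    rw [Complex.star_def, Complex.sub_conj]; push_cast; ring
  rw [← sub_mul, h]
  ring

/-- On the graph of `A` the form `ω(Y, Z^*)/i` is given by the imaginary part of `A`. -/
theorem symplBilin_star_of_graph (hA : A.IsSymm) {Y Z : Phase n ℂ} (hY : Y.1 = A *ᵥ Y.2)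
    (hZ : Z.1 = A *ᵥ Z.2) : (1 / Complex.I) * symplBilin n Y (star Z)
      = 2 * (Y.2 ⬝ᵥ ofRealMat (A.map Complex.im) *ᵥ star Z.2) := by
  have h1 : symplBilin n Y (star Z) = Y.2 ⬝ᵥ (A *ᵥ star Z.2 - star (A *ᵥ star (star Z.2))) := by
    rw [symplBilin_apply, symplForm_eq_dotProduct, hY, dotProduct_sub, star_star,
      dotProduct_mulVec_symm hA, dotProduct_comm (A *ᵥ Y.2)]
    rw [dotProduct_comm Y.2 (star _), ← hZ]
    rfl
  rw [h1, mulVec_sub_star_mulVec, dotProduct_smul, smul_eq_mul]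
  field_simp

theorem gaussian_eq (A : Matrix (Fin n) (Fin n) ℂ) (c : ℂ) (x : Fin n → ℝ) :
    gaussian A c x = c * Complex.exp (-realBilin ((-(Complex.I / 2)) • A) x x + 0) := by
  rw [gaussian, realBilin_apply, Matrix.smul_mulVec, dotProduct_smul]
  congr 2
  simp [dotProduct, Matrix.mulVec, ofRealVec_apply, Finset.mul_sum, mul_assoc]

theorem realBilin_smul_re_pos (hA : (A.map Complex.im).PosDef) (x : Fin n → ℝ) (hx : x ≠ 0) :
    0 < (realBilin ((-(Complex.I / 2)) • A) x x).re := by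
  have h := hA.dotProduct_mulVec_pos hx
  have h2 : (realBilin ((-(Complex.I / 2)) • A) x x).re
      = (1 / 2) * (star x ⬝ᵥ (A.map Complex.im *ᵥ x)) := by
    rw [realBilin_apply, Matrix.smul_mulVec, dotProduct_smul]
    simp [dotProduct, Matrix.mulVec, ofRealVec_apply, Finset.mul_sum]
  rw [h2]
  positivity

theorem exists_schwartz_eq_gaussian (hA : (A.map Complex.im).PosDef) (c : ℂ) :
    ∃ ψ : 𝓢(Fin n → ℝ, ℂ), ∀ x, ψ x = gaussian A c x := by
  obtain ⟨g, hg⟩ := exists_schwartz_gaussian _ (realBilin_smul_re_pos hA) 0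
  exact ⟨c • g, fun x => by rw [gaussian_eq, smul_apply, hg, smul_eq_mul]; rfl⟩

theorem fderiv_gaussian_single (hA : A.IsSymm) (c : ℂ) (x : Fin n → ℝ) (j : Fin n) :
    fderiv ℝ (gaussian A c) x (Pi.single j 1)
      = Complex.I * (A *ᵥ ofRealVec n x) j * gaussian A c x := by
  have hsymm : ((-(Complex.I / 2)) • A).IsSymm := hA.smul _
  have h := (hasFDerivAt_gaussian _ (realBilin_symm hsymm) 0 x).const_mul c
  have hfun : gaussian A c = fun x => c * Complex.exp
      (-realBilin ((-(Complex.I / 2)) • A) x x + (0 : (Fin n → ℝ) →ₗ[ℝ] ℂ) x) :=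
    funext (gaussian_eq A c)
  have hs : ofRealVec n (Pi.single j 1) = Pi.single j 1 := by
    ext i
    rcases eq_or_ne i j with rfl | hij
    · simp [ofRealVec_apply]
    · simp [ofRealVec_apply, hij]
  have hval : realBilin ((-(Complex.I / 2)) • A) x (Pi.single j 1)
      = -(Complex.I / 2) * (A *ᵥ ofRealVec n x) j := by
    rw [realBilin_symm hsymm, realBilin_apply, hs, Matrix.smul_mulVec, single_dotProduct, one_mul,
      Pi.smul_apply, smul_eq_mul]
  rw [hfun, h.fderiv]
  simp only [smul_apply, add_apply,
    LinearMap.coe_toContinuousLinearMap', hval, LinearMap.zero_apply, smul_eq_mul]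
  ring

/-- The derivative of the exponent turns Ω(Y) into multiplication by a linear function, which is
zero exactly for Y on the graph of A. -/
theorem OmegaOp_gaussian (hA : A.IsSymm) (c : ℂ) (Y : Phase n ℂ) (x : Fin n → ℝ) :
    OmegaOp Y (gaussian A c) x
      = ((Y.1 - A *ᵥ Y.2) ⬝ᵥ ofRealVec n x) * gaussian A c x := by
  rw [sub_dotProduct, dotProduct_comm (A *ᵥ Y.2), dotProduct_mulVec_symm hA]
  simp only [OmegaOp, fderiv_gaussian_single hA, dotProduct, sub_mul, Finset.sum_mul,
    ← Finset.sum_sub_distrib]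
  refine Finset.sum_congr rfl fun j _ => ?_
  rw [ofRealVec_apply]
  field_simp

/-- The overlap density of a Gaussian state with its phase space translate. -/
theorem star_gaussian_mul_weyl_gaussian (hA : A.IsSymm) (c : ℂ) {X : Phase n ℝ} {b : Phase n ℂ}
    (hb : b.1 = A *ᵥ b.2) (hX : X.toComplex = b + star b) (x : Fin n → ℝ) :
    star (gaussian A c x) * weyl X (gaussian A c) x
      = (star c * c * Complex.exp (-(star b.2 ⬝ᵥ ofRealMat (A.map Complex.im) *ᵥ (b.2 + star b.2))))
        * Complex.exp (-realBilin (ofRealMat (A.map Complex.im)) x x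
          + realFunctional ((2 : ℂ) • ofRealMat (A.map Complex.im) *ᵥ star b.2) x) := by
  set B := ofRealMat (A.map Complex.im)
  have hB : B.IsSymm := by
    ext i j
    simp [B, hA.apply i j]
  have hQ : ofRealVec n X.2 = b.2 + star b.2 := congrArg Prod.snd hX
  -- Conjugating Ab₂ replaces A by its conjugate A - 2iB, applied to b₂*.
  have hP : ofRealVec n X.1 = A *ᵥ ofRealVec n X.2 - (2 * Complex.I) • B *ᵥ star b.2 := by
    have h1 : ofRealVec n X.1 = b.1 + star b.1 := congrArg Prod.fst hX
    rw [h1, hQ, Matrix.mulVec_add, ← mulVec_sub_star_mulVec, star_star, hb]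
    abel
  have hg : ∀ y, gaussian A c y
      = c * Complex.exp ((Complex.I / 2) * (ofRealVec n y ⬝ᵥ A *ᵥ ofRealVec n y)) := by
    intro y
    rw [gaussian_eq, realBilin_apply, Matrix.smul_mulVec, dotProduct_smul]
    simp
  have hsg : star (gaussian A c x) = star c * Complex.exp (-(Complex.I / 2) *
      (ofRealVec n x ⬝ᵥ (A *ᵥ ofRealVec n x - (2 * Complex.I) • B *ᵥ ofRealVec n x))) := by
    have h := mulVec_sub_star_mulVec A (ofRealVec n x)
    rw [star_ofRealVec] at h
    have h2 : star (ofRealVec n x ⬝ᵥ A *ᵥ ofRealVec n x)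
        = ofRealVec n x ⬝ᵥ star (A *ᵥ ofRealVec n x) := by
      nth_rewrite 3 [← star_ofRealVec]
      rw [← Matrix.star_dotProduct_star, dotProduct_comm]
    rw [Complex.star_def] at h2
    rw [hg, star_mul', ← h, sub_sub_cancel, Complex.star_def, ← Complex.exp_conj,
      map_mul, h2, map_div₀, Complex.conj_I, map_ofNat, neg_div]
  have hw : ((∑ j, X.1 j * x j - (1 / 2) * ∑ j, X.1 j * X.2 j : ℝ) : ℂ)
      = ofRealVec n X.1 ⬝ᵥ ofRealVec n x - (1 / 2) * (ofRealVec n X.1 ⬝ᵥ ofRealVec n X.2) := by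
    simp [dotProduct, ofRealVec_apply]
  rw [weyl, hsg, hg, hw, map_sub]
  have hexp : ∀ a b c d e : ℂ, a * Complex.exp b * (Complex.exp c * (d * Complex.exp e))
      = a * d * Complex.exp (b + c + e) := by
    intro a b c d e
    rw [Complex.exp_add, Complex.exp_add]; ring
  rw [hexp, mul_assoc (star c * c), ← Complex.exp_add, ← hQ, realBilin_apply,
    realFunctional_apply, hP]
  congr 2
  simp only [Matrix.mulVec_sub, dotProduct_sub, sub_dotProduct, smul_dotProduct, dotProduct_smul,
    smul_eq_mul, dotProduct_comm (A *ᵥ _), dotProduct_comm (B *ᵥ _)]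
  rw [dotProduct_mulVec_symm hA (ofRealVec n X.2) (ofRealVec n x),
    dotProduct_mulVec_symm hB (star b.2) (ofRealVec n X.2)]
  linear_combination (ofRealVec n x ⬝ᵥ B *ᵥ ofRealVec n x
    - 2 * (ofRealVec n x ⬝ᵥ B *ᵥ star b.2) + ofRealVec n X.2 ⬝ᵥ B *ᵥ star b.2) * Complex.I_sq

/-- Wick's formula: (d,d) is the contraction of the two Ω factors, and the product term comes from
their means under the shifted Gaussian. Only d enters, since Y - d* is on the graph and annihilates
the state. -/
theorem integral_star_OmegaOp_mul_weyl (hA : A.IsSymm) (hpos : (A.map Complex.im).PosDef) (c : ℂ)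
    {Y d : Phase n ℂ} (hd : d.1 = A *ᵥ d.2) (hY : (Y - star d).1 = A *ᵥ (Y - star d).2)
    {X : Phase n ℝ} {b : Phase n ℂ} (hb : b.1 = A *ᵥ b.2) (hX : X.toComplex = b + star b) :
    ∫ x, star (OmegaOp Y (gaussian A c) x) * weyl X (OmegaOp Y (gaussian A c)) x
      = (star c * c * ∫ x, Complex.exp (-realBilin (ofRealMat (A.map Complex.im)) x x))
        * ((1 / Complex.I * symplBilin n d (star d)
            - (1 / Complex.I * symplBilin n d (star b)) * (1 / Complex.I * symplBilin n b (star d)))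
          * Complex.exp (-(1 / Complex.I * symplBilin n b (star b)) / 2)) := by
  rw [symplBilin_star_of_graph hA hd hd, symplBilin_star_of_graph hA hd hb,
    symplBilin_star_of_graph hA hb hd, symplBilin_star_of_graph hA hb hb]
  have hgauss := integral_gaussian_eq hpos (star b.2)
  have hmean := integral_gaussian_by_parts_complex hpos (star b.2) (star d.2) 0 1
  have hsymm := dotProduct_mulVec_symm (isSymm_ofRealMat hpos)
  have hQ : ofRealVec n X.2 = b.2 + star b.2 := congrArg Prod.snd hX
  obtain ⟨v, hv⟩ : ∃ v, v = Y.1 - A *ᵥ Y.2 := ⟨_, rfl⟩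
  have hvd : v = -(2 * Complex.I) • ofRealMat (A.map Complex.im) *ᵥ star d.2 := by
    have h1 : Y.1 = A *ᵥ Y.2 - A *ᵥ star d.2 + star d.1 := by
      have : Y.1 - star d.1 = A *ᵥ (Y.2 - star d.2) := hY
      rw [Matrix.mulVec_sub] at this
      rw [← this]; abel
    rw [hv, neg_smul, ← mulVec_sub_star_mulVec, star_star, h1, hd]
    abel
  have hparts := integral_gaussian_by_parts_complex hpos (star b.2) d.2 v (-(v ⬝ᵥ ofRealVec n X.2))
  have hre : ∀ x, x ≠ 0 → 0 < (realBilin (ofRealMat (A.map Complex.im)) x x).re := fun x hx =>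
    (Complex.lt_def.1 (realBilin_ofRealMat_pos hpos x hx)).1
  have hpt : ∀ x, star (OmegaOp Y (gaussian A c) x) * weyl X (OmegaOp Y (gaussian A c)) x
      = (star v ⬝ᵥ ofRealVec n x) * (v ⬝ᵥ ofRealVec n x + -(v ⬝ᵥ ofRealVec n X.2))
        * (star (gaussian A c x) * weyl X (gaussian A c) x) := by
    intro x
    have h1 : star (v ⬝ᵥ ofRealVec n x) = star v ⬝ᵥ ofRealVec n x := by
      nth_rewrite 2 [← star_ofRealVec]
      rw [← Matrix.star_dotProduct_star, dotProduct_comm]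
    simp only [weyl, OmegaOp_gaussian hA, ← hv, star_mul', h1, map_sub, dotProduct_sub]
    ring
  simp_rw [hpt, star_gaussian_mul_weyl_gaussian hA c hb hX]
  set B := ofRealMat (A.map Complex.im)
  set g : (Fin n → ℝ) → ℂ := fun x =>
    Complex.exp (-realBilin B x x + realFunctional ((2 : ℂ) • B *ᵥ star b.2) x)
  have hintg : ∀ {p : (Fin n → ℝ) → ℂ}, p.HasTemperateGrowth → Integrable fun x => p x * g x :=
    fun hp => integrable_temperate_mul_gaussian volume hre _ hp
  have hv1 : ∀ y, v ⬝ᵥ y = -(2 * Complex.I) * (star d.2 ⬝ᵥ B *ᵥ y) := by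
    intro y
    rw [hvd, smul_dotProduct, smul_eq_mul, dotProduct_comm (B *ᵥ _), hsymm]
  have hv2 : ∀ y, star v ⬝ᵥ y = (2 * Complex.I) * (d.2 ⬝ᵥ B *ᵥ y) := by
    intro y
    rw [hvd, star_smul, star_ofRealMat_mulVec, star_star, smul_dotProduct, smul_eq_mul,
      dotProduct_comm (B *ᵥ _), hsymm]
    simp
  have hT : ∀ w : Fin n → ℂ, Function.HasTemperateGrowth fun x => w ⬝ᵥ ofRealVec n x :=
    fun w => hasTemperateGrowth_linear (realFunctional w)
  have hT' : ∀ w : Fin n → ℂ, Function.HasTemperateGrowth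
      fun x => 2 * (w ⬝ᵥ B *ᵥ ofRealVec n x) - 2 * (w ⬝ᵥ B *ᵥ star b.2) := fun w => by
    simp_rw [Matrix.dotProduct_mulVec w]
    exact ((Function.HasTemperateGrowth.const 2).fun_mul (hT _)).fun_sub (.const _)
  have hTa : ∀ (w : Fin n → ℂ) (a : ℂ), Function.HasTemperateGrowth
      fun x => w ⬝ᵥ ofRealVec n x + a := fun w a => (hT w).fun_add (.const a)
  -- Centre the first linear factor at p = b₂*: integration by parts evaluates the centred part, and
  -- the mean multiplies a first moment.
  have hquad : ∫ x, (star v ⬝ᵥ ofRealVec n x)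
        * (v ⬝ᵥ ofRealVec n x + -(v ⬝ᵥ ofRealVec n X.2)) * g x
      = Complex.I * (v ⬝ᵥ d.2 * ∫ x, g x) + (2 * Complex.I * (d.2 ⬝ᵥ B *ᵥ star b.2))
        * ∫ x, (v ⬝ᵥ ofRealVec n x + -(v ⬝ᵥ ofRealVec n X.2)) * g x := by
    rw [← hparts, ← integral_const_mul, ← integral_const_mul, ← integral_add
      ((hintg ((hT' d.2).fun_mul (hTa v _))).const_mul _) ((hintg (hTa v _)).const_mul _)]
    refine integral_congr_ae (Filter.Eventually.of_forall fun x => ?_)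
    simp only [hv2, g]
    ring
  -- Integration by parts against the constant 1 shows that the mean of ξ is p.
  have hlin : ∫ x, (v ⬝ᵥ ofRealVec n x + -(v ⬝ᵥ ofRealVec n X.2)) * g x
      = (v ⬝ᵥ star b.2 + -(v ⬝ᵥ ofRealVec n X.2)) * ∫ x, g x := by
    rw [zero_dotProduct, zero_mul] at hmean
    have h0 := integral_add ((hintg ((hT' (star d.2)).fun_mul (hTa 0 1))).const_mul (-Complex.I))
      ((hintg (.const 1)).const_mul (v ⬝ᵥ star b.2 + -(v ⬝ᵥ ofRealVec n X.2)))
    rw [integral_const_mul, integral_const_mul, hmean, mul_zero, zero_add] at h0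
    simp only [one_mul] at h0
    rw [← h0]
    refine integral_congr_ae (Filter.Eventually.of_forall fun x => ?_)
    simp only [hv1, zero_dotProduct]
    ring
  have hK : ∀ x, (star v ⬝ᵥ ofRealVec n x) * (v ⬝ᵥ ofRealVec n x + -(v ⬝ᵥ ofRealVec n X.2))
        * (star c * c * Complex.exp (-(star b.2 ⬝ᵥ B *ᵥ (b.2 + star b.2))) * g x)
      = (star c * c * Complex.exp (-(star b.2 ⬝ᵥ B *ᵥ (b.2 + star b.2))))
        * ((star v ⬝ᵥ ofRealVec n x) * (v ⬝ᵥ ofRealVec n x + -(v ⬝ᵥ ofRealVec n X.2)) * g x) :=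
    fun x => by ring
  have hE : Complex.exp (-(star b.2 ⬝ᵥ B *ᵥ (b.2 + star b.2)))
      * Complex.exp (star b.2 ⬝ᵥ B *ᵥ star b.2)
      = Complex.exp (-(2 * (b.2 ⬝ᵥ B *ᵥ star b.2)) / 2) := by
    rw [← Complex.exp_add, Matrix.mulVec_add, dotProduct_add, hsymm (star b.2) b.2]
    ring_nf
  refine (integral_congr_ae (Filter.Eventually.of_forall hK)).trans ?_
  rw [integral_const_mul, hquad, hlin, hgauss, ← hE, hQ, dotProduct_add]
  simp only [hv1]
  rw [hsymm (star d.2) d.2, hsymm (star d.2) b.2]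
  linear_combination (star c * c * Complex.exp (-(star b.2 ⬝ᵥ B *ᵥ (b.2 + star b.2)))
    * (∫ x, Complex.exp (-realBilin B x x)) * Complex.exp (star b.2 ⬝ᵥ B *ᵥ star b.2)
    * (-2 * (d.2 ⬝ᵥ B *ᵥ star d.2)
      + 4 * (d.2 ⬝ᵥ B *ᵥ star b.2) * (b.2 ⬝ᵥ B *ᵥ star d.2))) * Complex.I_sq

end GaussianStates

/-! ### Integration over the constraint plane L. -/

section ConstraintInner

open MeasureTheory
open scoped Matrix ComplexOrder

variable {n : ℕ} {A : Matrix (Fin n) (Fin n) ℂ} {L : Submodule ℝ (Phase n ℝ)}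

/-- A quarter of the standard symmetric bilinear form, on a real subspace. -/
noncomputable def quarterDot (L : Submodule ℝ (Phase n ℝ)) : L →ₗ[ℝ] L →ₗ[ℝ] ℂ :=
  LinearMap.mk₂ ℝ (fun X Y => (1 / 4) * phaseDot n (X : Phase n ℝ).toComplex
      (Y : Phase n ℝ).toComplex)
    (fun X X' Y => by simp [Phase.toComplex_add]; ring)
    (fun c X Y => by simp [Phase.toComplex_smul]; ring)
    (fun X Y Y' => by simp [Phase.toComplex_add]; ring)
    (fun c X Y => by simp [Phase.toComplex_smul]; ring)

theorem quarterDot_apply (X Y : L) : quarterDot L X Y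
    = (1 / 4) * phaseDot n (X : Phase n ℝ).toComplex (Y : Phase n ℝ).toComplex := rfl

theorem quarterDot_pos (X : L) (hX : X ≠ 0) : 0 < quarterDot L X X := by
  have h0 : (X : Phase n ℝ).toComplex ≠ 0 := by
    intro h
    apply hX
    ext j
    · simpa [Phase.toComplex] using congrFun (congrArg Prod.fst h) j
    · simpa [Phase.toComplex] using congrFun (congrArg Prod.snd h) j
  have h := phaseDot_star_self_pos h0
  rw [Phase.star_toComplex] at h
  rw [quarterDot_apply]
  exact mul_pos (by norm_num) h

/-- The functional of a complex vector given by the standard symmetric bilinear form, on a real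
subspace. -/
noncomputable def phaseDotFunctional (L : Submodule ℝ (Phase n ℝ)) (Z : Phase n ℂ) :
    L →ₗ[ℝ] ℂ where
  toFun X := phaseDot n Z (X : Phase n ℝ).toComplex
  map_add' X Y := by simp [Phase.toComplex_add]
  map_smul' c X := by simp [Phase.toComplex_smul]

theorem phaseDotFunctional_apply (Z : Phase n ℂ) (X : L) :
    phaseDotFunctional L Z X = phaseDot n Z (X : Phase n ℝ).toComplex := rfl

variable (μ : Measure L) [μ.IsAddHaarMeasure]

theorem integrable_phaseDot_mul_phaseDot (Z Z₂ : Phase n ℂ) :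
    Integrable (fun X : L => phaseDotFunctional L Z X * phaseDotFunctional L Z₂ X
      * Complex.exp (-quarterDot L X X)) μ := by
  simpa using integrable_temperate_mul_gaussian μ
    (fun X hX => (Complex.lt_def.1 (quarterDot_pos (L := L) X hX)).1) 0
    ((hasTemperateGrowth_linear (phaseDotFunctional L Z)).fun_mul
      (hasTemperateGrowth_linear (phaseDotFunctional L Z₂)))

/-- Second moments of the Gaussian measure on a real subspace. -/
theorem integral_phaseDot_mul_phaseDot {Z : Phase n ℂ} (hZ : Z ∈ complexify L) (Z₂ : Phase n ℂ) :
    ∫ X : L, phaseDotFunctional L Z X * phaseDotFunctional L Z₂ X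
        * Complex.exp (-quarterDot L X X) ∂μ
      = 2 * phaseDot n Z Z₂ * ∫ X : L, Complex.exp (-quarterDot L X X) ∂μ := by
  have hreal : ∀ w : L, ∫ X : L, phaseDotFunctional L (w : Phase n ℝ).toComplex X
        * phaseDotFunctional L Z₂ X * Complex.exp (-quarterDot L X X) ∂μ
      = 2 * phaseDot n (w : Phase n ℝ).toComplex Z₂
        * ∫ X : L, Complex.exp (-quarterDot L X X) ∂μ := by
    intro w
    -- Here 2β(w,X) = w·X/2, which is the origin of the factor 2 in the second moment.
    have h := integral_gaussian_by_parts μ (β := quarterDot L)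
      (fun X Y => by rw [quarterDot_apply, quarterDot_apply, phaseDot_comm])
      (fun X hX => (Complex.lt_def.1 (quarterDot_pos X hX)).1) 0 (phaseDotFunctional L Z₂) 0 w
    simp only [LinearMap.zero_apply, add_zero, sub_zero] at h
    rw [phaseDot_comm, mul_assoc, ← phaseDotFunctional_apply, ← h, ← integral_const_mul]
    refine integral_congr_ae (Filter.Eventually.of_forall fun X => ?_)
    simp only [phaseDotFunctional_apply, quarterDot_apply]
    ring
  obtain ⟨X₁, h₁, X₂, h₂, rfl⟩ := exists_of_mem_complexify hZ
  have hsum := integral_add (integrable_phaseDot_mul_phaseDot μ X₁.toComplex Z₂)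
    ((integrable_phaseDot_mul_phaseDot μ X₂.toComplex Z₂).const_mul Complex.I)
  rw [integral_const_mul, hreal ⟨X₁, h₁⟩, hreal ⟨X₂, h₂⟩] at hsum
  rw [map_add, map_smul, LinearMap.add_apply, LinearMap.smul_apply, smul_eq_mul]
  refine Eq.trans ?_ (hsum.trans (by ring))
  refine integral_congr_ae (Filter.Eventually.of_forall fun X => ?_)
  simp only [phaseDotFunctional_apply, map_add, map_smul, LinearMap.add_apply,
    LinearMap.smul_apply, smul_eq_mul]
  ring

/-- The constrained norm of `Ω(Y) ψ` for a Gaussian state `ψ` and `Y = X + V + W^*`: only the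
component `W` contributes. -/
theorem constraintInner_OmegaOp_gaussian (hA : A.IsSymm) (hpos : (A.map Complex.im).PosDef)
    (hLiso : ∀ X ∈ complexify L, ∀ X' ∈ complexify L, symplBilin n X X' = 0)
    (hLA : ∀ X ∈ complexify L, (X - Complex.I • phaseRot n X).1
        = A *ᵥ (X - Complex.I • phaseRot n X).2) (c : ℂ)
    {X₀ V W : Phase n ℂ} (hX₀ : X₀ ∈ complexify L) (hV : V.1 = A *ᵥ V.2) (hW : W.1 = A *ᵥ W.2)
    (hWL : ∀ X ∈ complexify L, symplBilin n W X = 0)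
    (hWL' : ∀ X ∈ complexify L, phaseDot n W X = 0) :
    constraintInner L μ (OmegaOp (X₀ + V + star W) (gaussian A c))
        (OmegaOp (X₀ + V + star W) (gaussian A c))
      = (star c * c * ∫ x, Complex.exp (-realBilin (ofRealMat (A.map Complex.im)) x x))
        * (1 / Complex.I * symplBilin n W (star W))
        * ∫ X : L, Complex.exp (-quarterDot L X X) ∂μ := by
  set K := star c * c * ∫ x, Complex.exp (-realBilin (ofRealMat (A.map Complex.im)) x x)
  have hX₀' := star_mem_complexify hX₀
  have hgraph_add : ∀ {Y Z : Phase n ℂ} (a : ℂ), Y.1 = A *ᵥ Y.2 → Z.1 = A *ᵥ Z.2 →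
      (a • Y + Z).1 = A *ᵥ (a • Y + Z).2 := by
    intro Y Z a hY hZ
    simp [hY, hZ, Matrix.mulVec_add, Matrix.mulVec_smul]
  have hLW : ∀ X ∈ complexify L, symplBilin n X (star W) = 0 := by
    intro X hX
    rw [← star_eq_zero, star_symplBilin, star_star, symplBilin_swap,
      hWL _ (star_mem_complexify hX), neg_zero]
  have hLW' : ∀ X ∈ complexify L, phaseDot n X (star W) = 0 := by
    intro X hX
    rw [← star_eq_zero, star_phaseDot, star_star, phaseDot_comm, hWL' _ (star_mem_complexify hX)]
  have hinner : ∀ X : L, (∫ x, star (OmegaOp (X₀ + V + star W) (gaussian A c) x)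
        * weyl (X : Phase n ℝ) (OmegaOp (X₀ + V + star W) (gaussian A c)) x)
      = K * (((1 / 2) * phaseDot n (star X₀) X₀ + 1 / Complex.I * symplBilin n W (star W)
          - (1 / 4) * (phaseDotFunctional L (star X₀) X * phaseDotFunctional L X₀ X))
        * Complex.exp (-quarterDot L X X)) := by
    intro X
    obtain ⟨U, hU⟩ : ∃ U, U = (X : Phase n ℝ).toComplex := ⟨_, rfl⟩
    have hUL : U ∈ complexify L := hU ▸ toComplex_mem_complexify X.2
    have hUs : star U = U := by rw [hU, Phase.star_toComplex]
    have hb : ((1 / 2 : ℂ) • (U - Complex.I • phaseRot n U)).1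
        = A *ᵥ ((1 / 2 : ℂ) • (U - Complex.I • phaseRot n U)).2 := by
      simpa using hgraph_add (1 / 2) (hLA U hUL) (Z := 0) (by simp)
    -- X₀ is the sum of (X₀ - iJX₀)/2, on the graph, and (X₀ + iJX₀)/2, the conjugate of the graph
    -- vector built from X₀*. The latter goes into d, the former joins V. For the real vector X the
    -- same splitting gives X = b + b*.
    have hd := hgraph_add (1 / 2) (hLA _ hX₀') hW
    rw [integral_star_OmegaOp_mul_weyl hA hpos c hd ?_ hb ?_]
    · simp only [phaseDotFunctional_apply, quarterDot_apply, ← hU]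
      congr 1
      have e1 := hLiso _ hX₀' _ hX₀
      have e2 := hLiso _ hX₀' _ hUL
      have e3 := hLiso _ hUL _ hX₀
      have e4 := hLiso _ hUL _ hUL
      have e5 := hLW _ hX₀'
      have e6 := hLW' _ hX₀'
      have e7 := hLW _ hUL
      have e8 := hLW' _ hUL
      have e9 := hWL _ hX₀
      have e10 := hWL' _ hX₀
      have e11 := hWL _ hUL
      have e12 := hWL' _ hUL
      have e13 := phaseDot_comm U X₀
      simp only [star_add, star_sub, star_smul, star_phaseRot, star_star, hUs, map_add, map_sub,
        map_smul, LinearMap.add_apply, LinearMap.sub_apply, LinearMap.smul_apply, smul_eq_mul,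
        symplBilin_rot_left, symplBilin_rot_right, phaseDot_rot_left, e1, e2, e3, e4, e5, e6, e7,
        e8, e9, e10, e11, e12, e13]
      simp
      congr 1
      · linear_combination (-(1 / 2) * phaseDot n (star X₀) X₀
          - (1 / 4) * (phaseDot n (star X₀) U * phaseDot n X₀ U) * (Complex.I ^ 2 - 1))
          * Complex.I_sq
      · congr 1
        linear_combination (phaseDot n U U / 4) * Complex.I_sq
    · have : X₀ + V + star W - star ((1 / 2 : ℂ) • (star X₀ - Complex.I • phaseRot n (star X₀)) + W)
          = (1 / 2 : ℂ) • (X₀ - Complex.I • phaseRot n X₀) + V := by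
        simp only [star_add, star_smul, star_sub, star_phaseRot, star_star]
        simp
        module
      rw [this]
      exact hgraph_add _ (hLA X₀ hX₀) hV
    · rw [← hU, star_smul, star_sub, star_smul, star_phaseRot, hUs]
      simp
      module
  have hsq := (integrable_phaseDot_mul_phaseDot μ (star X₀) X₀).const_mul (-(1 / 4))
  have hg : Integrable (fun X : L => Complex.exp (-quarterDot L X X)) μ := by
    simpa using integrable_gaussian μ
      (fun X hX => (Complex.lt_def.1 (quarterDot_pos (L := L) X hX)).1) 0
  have hsum := integral_add (hg.const_mul
    ((1 / 2) * phaseDot n (star X₀) X₀ + 1 / Complex.I * symplBilin n W (star W))) hsq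
  -- The moment 2 X₀*·X₀ with weight -1/4 cancels the term X₀*·X₀/2, so Ω(X₀) contributes nothing.
  rw [integral_const_mul, integral_const_mul, integral_phaseDot_mul_phaseDot μ hX₀'] at hsum
  rw [constraintInner]
  simp_rw [hinner]
  rw [integral_const_mul, mul_assoc K]
  congr 1
  refine Eq.trans ?_ (hsum.trans (by ring))
  refine integral_congr_ae (Filter.Eventually.of_forall fun X => ?_)
  dsimp only
  ring

end ConstraintInner

/-! ### The H-germ of the Gaussian is r. -/

open scoped SchwartzMap ComplexOrder in
theorem lemma12 {n k : ℕ}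
    (L : Submodule ℝ (Phase n ℝ))
    (hk : Module.finrank ℝ L = k)
    (hL : ∀ X ∈ L, ∀ X' ∈ L, symplForm X X' = 0)
    (μ : MeasureTheory.Measure L) [μ.IsAddHaarMeasure]
    (r : Submodule ℂ (Phase n ℂ))
    (hdim : Module.finrank ℂ r = n)
    (hiso : ∀ Y₁ ∈ r, ∀ Y₂ ∈ r, symplForm Y₁ Y₂ = 0)
    (hLr : ∀ Y ∈ complexify L, Y ∈ r ∧ symplForm Y (star Y) = 0)
    (hpos : ∀ Y ∈ r, Y ∉ complexify L → 0 < (1 / Complex.I) * symplForm Y (star Y)) :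
    skewOrth (complexify L) = r ⊔ conjSubspace r ∧
    r ⊓ conjSubspace r = complexify L ∧
    ∃ A : Matrix (Fin n) (Fin n) ℂ, A.IsSymm ∧ (A.map Complex.im).PosDef ∧
      ∀ c : ℂ, c ≠ 0 → ∃ ψ : 𝓢(Fin n → ℝ, ℂ),
        (∀ ξ, ψ ξ = gaussian A c ξ) ∧ hGerm L μ ψ = (r : Set (Phase n ℂ)) := by
  have hle : complexify L ≤ r := fun Y hY => (hLr Y hY).1
  have hinf := inf_conjSubspace_eq_complexify hiso hle hpos
  have hsup := skewOrth_eq_sup_conjSubspace hdim hiso hinf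
  refine ⟨hsup, hinf, ?_⟩
  obtain ⟨A, hA, hApos, hLA, hNA⟩ := exists_matrix_of_nonneg_lagrangian hdim hiso hle hpos
  refine ⟨A, hA, hApos, fun c hc => ?_⟩
  obtain ⟨ψ, hψ⟩ := exists_schwartz_eq_gaussian hApos c
  have hfun : (ψ : (Fin n → ℝ) → ℂ) = gaussian A c := funext hψ
  have hLiso : ∀ X ∈ complexify L, ∀ X' ∈ complexify L, symplBilin n X X' = 0 :=
    fun X hX X' hX' => hiso X (hle hX) X' (hle hX')
  have hval := fun {X₀ V W : Phase n ℂ} => constraintInner_OmegaOp_gaussian (X₀ := X₀) (V := V)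
    (W := W) μ hA hApos hLiso hLA c
  refine ⟨ψ, hψ, Set.Subset.antisymm ?_ fun Y hY => ?_⟩
  · rintro Y ⟨hY, h0⟩
    rw [hsup] at hY
    obtain ⟨Z, hZ, Z', hZ', rfl⟩ := Submodule.mem_sup.1 hY
    obtain ⟨X₁, hX₁, V, hV, hVL, rfl⟩ := exists_add_orthogonal hle hZ
    obtain ⟨X₂, hX₂, W, hW, hWL, hZW⟩ := exists_add_orthogonal hle (mem_conjSubspace.1 hZ')
    have hY' : X₁ + V + Z' = (X₁ + star X₂) + V + star W := by
      rw [← star_star Z', hZW, star_add]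
      abel
    -- L^ℂ is conjugation stable, so both null components merge into one X₀, and the norm sees only
    -- W.
    rw [hfun, hY', hval (add_mem hX₁ (star_mem_complexify hX₂)) (hNA V hV hVL) (hNA W hW hWL)
      (fun X hX => hiso W hW X (hle hX)) hWL] at h0
    have hWL' : W ∈ complexify L := by
      by_contra hW'
      have h1 := (hpos W hW hW').ne'
      have h2 := integral_gaussian_ne_zero μ (quarterDot_pos (L := L))
      have h3 := integral_gaussian_ne_zero MeasureTheory.volume (realBilin_ofRealMat_pos hApos)
      exact mul_ne_zero (mul_ne_zero (mul_ne_zero (mul_ne_zero (star_ne_zero.2 hc) hc) h3) h1) h2 h0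
    rw [hY']
    exact r.add_mem (r.add_mem (hle (add_mem hX₁ (star_mem_complexify hX₂))) hV)
      (hle (star_mem_complexify hWL'))
  · refine ⟨fun X hX => hiso Y hY X (hle hX), ?_⟩
    obtain ⟨X₁, hX₁, V, hV, hVL, rfl⟩ := exists_add_orthogonal hle hY
    -- Vectors of r have no component in N*, so the norm formula gives zero.
    have h := hval hX₁ (hNA V hV hVL) (W := 0) (by simp) (by simp) (by simp)
    rw [hfun]
    simpa using h
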